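/- Definitions. For an ideal $I$ of a commutative ring $R$ and $f\in R$ put $\nu_I(f)=\sup\{n\in\mathbb N : f\in I^n\}$ and $\bar\nu_I(f)=\lim_{n\to\infty}\nu_I(f^n)/n\in[0,\infty]$ (this limit exists). For $b\ge 0$ let $I^{(\ge b)}=\{g : \bar\nu_I(g)\ge b\}$ and $I^{(>b)}=\{g : \bar\nu_I(g)>b\}$. For a Noetherian local ring $(R,\mathfrak m)$ let $$\lambda_{\mathfrak m}:\mathfrak m/\mathfrak m^2\to \mathfrak m^{(\ge 1)}/\mathfrak m^{(>1)}$$ be the natural map sending the class of $x$ to the class of $x$; its kernel is a subspace of the $R/\mathfrak m$-vector space $\mathfrak m/\mathfrak m^2$. The excess of embedding dimension of $R$ is $t=\dim_{R/\mathfrak m}(\mathfrak m/\mathfrak m^2)-\dim R$. If $t>0$, then $R$ is in the extremal case if $\dim\ker(\lambda_{\mathfrak m})=t$; in that case a $\lambda_{\mathfrak m}$-sequence is a sequence $\gamma_1,\dots,\gamma_t\in\mathfrak m$ whose classes in $\mathfrak m/\mathfrak m^2$ form a basis of $\ker(\lambda_{\mathfrak m})$, and the Samuel slope $\mathcal S\text{-Sl}(R)$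 is the supremum of $\min_i\bar\nu_{\mathfrak m}(\gamma_i)$ over all $\lambda_{\mathfrak m}$-sequences. (If $t>0$ and $\dim\ker(\lambda_{\mathfrak m})<t$, then $\mathcal S\text{-Sl}(R)=1$.) The multiplicity of $R$ is $\lim_{n\to\infty} (\dim R)!\,\mathrm{length}(R/\mathfrak m^n)/n^{\dim R}$. The ring $R$ is formally $d$-equidimensional if $\dim \hat R/\mathfrak q=d$ for every minimal prime $\mathfrak q$ of its $\mathfrak m$-adic completion $\hat R$. An étale homomorphism of local rings $A\to A'$ is one for which $A'$ is the localization of an étale $A$-algebra at a prime lying over the maximal ideal of $A$. Proposition 3.8. Let $(A,\mathfrak m)$ be a formally $d$-equidimensional Noetherian local ring. Let $\mathfrak p\subset A$ be a prime ideal such that $A/\mathfrak p$ is a regular ring of dimension $d-r$ with $r>0$, and such that $A$ and $A_{\mathfrak p}$ have the same multiplicity $m>1$. Suppose that $A$ and $A_{\mathfrak p}$ have the same excess of embedding dimension $t$, and that both are in the extremal case. Let $(A,\mathfrak m)\to(A',\mathfrak m')$ be an étale homomorphism of local rings that induces an isomorphism $A/\mathfrak m\cong A'/\mathfrak m'$ of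 residue fields, and let $\mathfrak p'\subset A'$ be a prime ideal with $\mathfrak p'\cap A=\mathfrak p$. Let $\gamma'_1,\dots,\gamma'_t\in A'$ be a $\lambda_{\mathfrak m'}$-sequence whose images in $A'_{\mathfrak p'}$ form a $\lambda_{\mathfrak p'A'_{\mathfrak p'}}$-sequence. Then there are $\gamma_1,\dots,\gamma_t\in\mathfrak p$ whose images in $A_{\mathfrak p}$ form a $\lambda_{\mathfrak pA_{\mathfrak p}}$-sequence, such that $$\min_i\bar\nu_{\mathfrak p}(\gamma_i)\ \ge\ \min_i\bar\nu_{\mathfrak p'}(\gamma'_i)\qquad\text{and}\qquad \min_i\bar\nu_{\mathfrak pA_{\mathfrak p}}(\gamma_i)\ \ge\ \min_i\bar\nu_{\mathfrak p'A'_{\mathfrak p'}}(\gamma'_i).$$ In particular $\mathcal S\text{-Sl}(A_{\mathfrak p})\ \ge\ \min_i\bar\nu_{\mathfrak p'A'_{\mathfrak p'}}(\gamma'_i)$. -/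

import Mathlib

open Filter Topology
open scoped ENNReal NNReal Nat

namespace SamuelSlope

/-! ### The asymptotic Samuel function of an ideal -/

section AsymptoticSamuel

/-- The order `ν_I(f) = sup {m ∈ ℕ | f ∈ I ^ m}` of `f` along `I`, with values in `ℕ ∪ {∞}`. -/
noncomputable def idealOrd {R : Type*} [CommRing R] (I : Ideal R) (f : R) : ℕ∞ :=
  ⨆ (m : ℕ) (_ : f ∈ I ^ m), (m : ℕ∞)

/-- The asymptotic Samuel function `ν̄_I(f) = lim_{n → ∞} ν_I(f ^ n) / n`, with values in
`[0, ∞]`. The limit exists for every `f`, see `tendsto_asymptoticSamuel`. -/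
noncomputable def asymptoticSamuel {R : Type*} [CommRing R] (I : Ideal R) (f : R) : ℝ≥0∞ :=
  limUnder atTop (fun n : ℕ => (idealOrd I (f ^ n) : ℝ≥0∞) / n)

variable {R : Type*} [CommRing R] (I : Ideal R)

theorem natCast_le_idealOrd {f : R} {m : ℕ} (h : f ∈ I ^ m) : (m : ℕ∞) ≤ idealOrd I f :=
  le_iSup₂_of_le m h le_rfl

theorem exists_of_lt_asymptotic {f : R} {k : ℕ} (hk : 0 < k) {c : ℝ≥0}
    (h : (c : ℝ≥0∞) < (idealOrd I (f ^ k) : ℝ≥0∞) / k) :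
    ∃ M : ℕ, f ^ k ∈ I ^ M ∧ (c * k : ℝ) < M := by
  rw [ENNReal.lt_div_iff_mul_lt (Or.inl (by positivity)) (Or.inl (by simp))] at h
  by_contra! hcon
  refine absurd h (not_lt.mpr ?_)
  have h1 : idealOrd I (f ^ k) ≤ (⌊c * k⌋₊ : ℕ) := by
    refine iSup₂_le fun m hm => ?_
    have := hcon m hm
    rw [Nat.cast_le]
    apply Nat.le_floor
    exact_mod_cast this
  calc (idealOrd I (f ^ k) : ℝ≥0∞) ≤ ((⌊c * k⌋₊ : ℕ) : ℝ≥0∞) := by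
        have := ENat.toENNReal_le.mpr h1
        simpa using this
    _ = (((⌊c * k⌋₊ : ℕ) : ℝ≥0) : ℝ≥0∞) := by simp
    _ ≤ ((c * k : ℝ≥0) : ℝ≥0∞) := ENNReal.coe_le_coe.mpr (Nat.floor_le (by positivity))
    _ = c * k := by simp

theorem lt_asymptotic_of_mem {f : R} {n N : ℕ} (hn : 0 < n) {c : ℝ≥0}
    (h : f ^ n ∈ I ^ N) (hc : (c * n : ℝ) < N) :
    (c : ℝ≥0∞) < (idealOrd I (f ^ n) : ℝ≥0∞) / n := by
  rw [ENNReal.lt_div_iff_mul_lt (Or.inl (by positivity)) (Or.inl (by simp))]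
  have h1 : ((N : ℕ) : ℝ≥0∞) ≤ (idealOrd I (f ^ n) : ℝ≥0∞) := by
    have := ENat.toENNReal_le.mpr (natCast_le_idealOrd I h)
    simpa using this
  refine lt_of_lt_of_le ?_ h1
  have h2 : c * (n : ℝ≥0) < (N : ℝ≥0) := by exact_mod_cast hc
  have := ENNReal.coe_lt_coe.mpr h2
  simpa using this

theorem eventually_lt_asymptotic {f : R} {k M : ℕ} (hk : 0 < k) {c : ℝ≥0}
    (h : f ^ k ∈ I ^ M) (hc : (c * k : ℝ) < M) :
    ∀ᶠ n : ℕ in atTop, (c : ℝ≥0∞) < (idealOrd I (f ^ n) : ℝ≥0∞) / n := by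
  obtain ⟨n₀, hn₀⟩ := exists_nat_gt ((M * k : ℝ) / (M - c * k))
  filter_upwards [eventually_ge_atTop n₀, eventually_gt_atTop 0] with n hn hpos
  have hmem : f ^ n ∈ I ^ (M * (n / k)) := by
    rw [pow_mul]
    have : f ^ n = (f ^ k) ^ (n / k) * f ^ (n % k) := by
      rw [← pow_mul, ← pow_add, Nat.div_add_mod]
    rw [this]
    exact Ideal.mul_mem_right _ _ (Ideal.pow_mem_pow h _)
  refine lt_asymptotic_of_mem I hpos hmem ?_
  have hd : (0 : ℝ) < M - c * k := by linarith
  rw [div_lt_iff₀ hd] at hn₀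
  have hn' : (n₀ : ℝ) ≤ n := by exact_mod_cast hn
  have h1 : (n : ℝ) = k * ((n / k : ℕ) : ℝ) + ((n % k : ℕ) : ℝ) := by
    exact_mod_cast (Nat.div_add_mod n k).symm
  have h2 : ((n % k : ℕ) : ℝ) < k := by exact_mod_cast Nat.mod_lt n hk
  have hk' : (0 : ℝ) < k := by exact_mod_cast hk
  push_cast
  have h3 : (M * k : ℝ) < n * (M - c * k) := by nlinarith
  have hM : (0 : ℝ) ≤ M := by positivity
  have h4 : (c * n : ℝ) * k < (M * ((n / k : ℕ) : ℝ)) * k := by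
    have : (M : ℝ) * ((n % k : ℕ) : ℝ) ≤ M * k := by nlinarith
    nlinarith
  exact lt_of_mul_lt_mul_right h4 hk'.le

/-- The limit defining the asymptotic Samuel function exists. -/
theorem tendsto_asymptoticSamuel (f : R) :
    Tendsto (fun n : ℕ => (idealOrd I (f ^ n) : ℝ≥0∞) / n) atTop
      (𝓝 (asymptoticSamuel I f)) := by
  apply tendsto_nhds_limUnder
  refine ⟨⨆ n : ℕ, (idealOrd I (f ^ (n + 1)) : ℝ≥0∞) / (n + 1 : ℕ), ?_⟩
  rw [tendsto_order]
  constructor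
  · intro a ha
    lift a to ℝ≥0 using (lt_of_lt_of_le ha le_top).ne
    obtain ⟨k, hk⟩ := lt_iSup_iff.mp ha
    obtain ⟨M, hM, hM'⟩ := exists_of_lt_asymptotic I k.succ_pos hk
    exact eventually_lt_asymptotic I k.succ_pos hM hM'
  · intro a ha
    filter_upwards [eventually_gt_atTop 0] with n hn
    obtain ⟨k, rfl⟩ := Nat.exists_eq_succ_of_ne_zero hn.ne'
    exact lt_of_le_of_lt
      (le_iSup (fun n : ℕ => (idealOrd I (f ^ (n + 1)) : ℝ≥0∞) / (n + 1 : ℕ)) k) ha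

theorem coe_lt_asymptoticSamuel_iff {f : R} {c : ℝ≥0} :
    (c : ℝ≥0∞) < asymptoticSamuel I f ↔
      ∃ k M : ℕ, 0 < k ∧ f ^ k ∈ I ^ M ∧ (c * k : ℝ) < M := by
  have ht := tendsto_asymptoticSamuel I f
  constructor
  · intro h
    obtain ⟨n, hn, hpos⟩ := ((ht.eventually_const_lt h).and (eventually_gt_atTop 0)).exists
    obtain ⟨M, hM, hM'⟩ := exists_of_lt_asymptotic I hpos hn
    exact ⟨n, M, hpos, hM, hM'⟩
  · rintro ⟨k, M, hk, hM, hc⟩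
    obtain ⟨d, hcd, hd⟩ : ∃ d : ℝ≥0, c < d ∧ (d * k : ℝ) < M := by
      have hk' : (0 : ℝ) < k := by exact_mod_cast hk
      obtain ⟨x, hx1, hx2⟩ := exists_between ((lt_div_iff₀ hk').mpr hc)
      exact ⟨⟨x, c.2.trans hx1.le⟩, hx1, (lt_div_iff₀ hk').mp hx2⟩
    refine lt_of_lt_of_le (ENNReal.coe_lt_coe.mpr hcd) (ge_of_tendsto ht ?_)
    exact (eventually_lt_asymptotic I hk hM hd).mono fun _ h => h.le

theorem asymptoticSamuel_mul_left (a f : R) :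
    asymptoticSamuel I f ≤ asymptoticSamuel I (a * f) := by
  refine ENNReal.le_of_forall_nnreal_lt fun c hc => ?_
  obtain ⟨k, M, hk, hM, h⟩ := (coe_lt_asymptoticSamuel_iff I).mp hc
  refine ((coe_lt_asymptoticSamuel_iff I).mpr ⟨k, M, hk, ?_, h⟩).le
  rw [mul_pow]
  exact Ideal.mul_mem_left _ _ hM

theorem asymptoticSamuel_add (f g : R) :
    min (asymptoticSamuel I f) (asymptoticSamuel I g) ≤ asymptoticSamuel I (f + g) := by
  refine ENNReal.le_of_forall_nnreal_lt fun c hc => ?_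
  rw [lt_min_iff] at hc
  obtain ⟨k, M, hk, hM, h⟩ := (coe_lt_asymptoticSamuel_iff I).mp hc.1
  obtain ⟨l, N, hl, hN, h'⟩ := (coe_lt_asymptoticSamuel_iff I).mp hc.2
  obtain ⟨K, P, hK, hf, hg, hP⟩ : ∃ K P : ℕ, 0 < K ∧ f ^ K ∈ I ^ P ∧ g ^ K ∈ I ^ P ∧
      (c * K : ℝ) < P := by
    have hk' : (0 : ℝ) < k := by exact_mod_cast hk
    have hl' : (0 : ℝ) < l := by exact_mod_cast hl
    refine ⟨k * l, min (M * l) (N * k), Nat.mul_pos hk hl, ?_, ?_, ?_⟩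
    · refine Ideal.pow_le_pow_right (min_le_left _ _) ?_
      rw [pow_mul, pow_mul]
      exact Ideal.pow_mem_pow hM _
    · refine Ideal.pow_le_pow_right (min_le_right _ _) ?_
      rw [mul_comm k l, pow_mul, pow_mul]
      exact Ideal.pow_mem_pow hN _
    · push_cast
      rw [lt_min_iff]
      constructor <;> nlinarith
  obtain ⟨q, hq⟩ := exists_nat_gt ((P : ℝ) / (P - c * K))
  have hd : (0 : ℝ) < P - c * K := by linarith
  have hP0 : (0 : ℝ) ≤ P := by positivity
  have hq0 : 0 < q := by
    have : (0 : ℝ) < q := lt_of_le_of_lt (by positivity) hq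
    exact_mod_cast this
  rw [div_lt_iff₀ hd] at hq
  refine ((coe_lt_asymptoticSamuel_iff I).mpr
    ⟨q * K, P * (q - 1), Nat.mul_pos hq0 hK, ?_, ?_⟩).le
  · have aux : ∀ {x : R} (_ : x ^ K ∈ I ^ P) (i : ℕ), x ^ i ∈ I ^ (P * (i / K)) := by
      intro x hx i
      have : x ^ i = (x ^ K) ^ (i / K) * x ^ (i % K) := by
        rw [← pow_mul, ← pow_add, Nat.div_add_mod]
      rw [this, pow_mul]
      exact Ideal.mul_mem_right _ _ (Ideal.pow_mem_pow hx _)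
    rw [add_pow]
    refine Ideal.sum_mem _ fun i hi => Ideal.mul_mem_right _ _ ?_
    have hi' : i ≤ q * K := Nat.lt_succ_iff.mp (Finset.mem_range.mp hi)
    refine Ideal.pow_le_pow_right ?_
      (by rw [pow_add]; exact Ideal.mul_mem_mul (aux hf i) (aux hg (q * K - i)))
    rw [← mul_add]
    refine Nat.mul_le_mul_left _ ?_
    have h1 := Nat.div_add_mod i K
    have h2 := Nat.div_add_mod (q * K - i) K
    have h3 := Nat.mod_lt i hK
    have h4 := Nat.mod_lt (q * K - i) hK
    have h5 : q * K < (i / K + (q * K - i) / K + 2) * K := by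
      have : i + (q * K - i) = q * K := by omega
      nlinarith
    have h6 := lt_of_mul_lt_mul_right h5 (Nat.zero_le K)
    omega
  · push_cast [Nat.cast_sub (Nat.succ_le_of_lt hq0)]
    nlinarith

theorem asymptoticSamuel_zero : asymptoticSamuel I 0 = ∞ := by
  refine ENNReal.eq_top_of_forall_nnreal_le fun c => ?_
  obtain ⟨M, hM⟩ := exists_nat_gt ((c : ℝ) * (1 : ℕ))
  exact ((coe_lt_asymptoticSamuel_iff I).mpr ⟨1, M, one_pos, by simp, hM⟩).le

theorem natCast_le_asymptoticSamuel {f : R} {m : ℕ} (h : f ∈ I ^ m) :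
    (m : ℝ≥0∞) ≤ asymptoticSamuel I f := by
  refine ENNReal.le_of_forall_nnreal_lt fun c hc => ?_
  have hc' : c < (m : ℝ≥0) := by
    rw [← ENNReal.coe_lt_coe]
    simpa using hc
  refine ((coe_lt_asymptoticSamuel_iff I).mpr ⟨1, m, one_pos, by simpa using h, ?_⟩).le
  have : (c : ℝ) < m := by exact_mod_cast hc'
  simpa using this

/-- The ideal `I^{(≥ b)} = {g | ν̄_I(g) ≥ b}`. -/
def geIdeal (b : ℝ≥0) : Ideal R where
  carrier := {g | (b : ℝ≥0∞) ≤ asymptoticSamuel I g}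
  zero_mem' := by simp [asymptoticSamuel_zero]
  add_mem' {f g} hf hg := (le_min hf hg).trans (asymptoticSamuel_add I f g)
  smul_mem' a f hf := le_trans hf (asymptoticSamuel_mul_left I a f)

/-- The ideal `I^{(> b)} = {g | ν̄_I(g) > b}`. -/
def gtIdeal (b : ℝ≥0) : Ideal R where
  carrier := {g | (b : ℝ≥0∞) < asymptoticSamuel I g}
  zero_mem' := by simp [asymptoticSamuel_zero]
  add_mem' {f g} hf hg := (lt_min hf hg).trans_le (asymptoticSamuel_add I f g)
  smul_mem' a f hf := lt_of_lt_of_le hf (asymptoticSamuel_mul_left I a f)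

theorem le_geIdeal_one : I ≤ geIdeal I 1 := fun f hf => by
  have h : f ∈ I ^ 1 := by simpa using hf
  simpa [geIdeal] using natCast_le_asymptoticSamuel I h

theorem sq_le_gtIdeal_one : I ^ 2 ≤ gtIdeal I 1 := fun f hf => by
  have h2 := natCast_le_asymptoticSamuel I hf
  refine lt_of_lt_of_le ?_ h2
  simp

end AsymptoticSamuel

/-! ### The map `λ_𝔪`, `λ_𝔪`-sequences and the Samuel slope of a local ring -/

section LocalRing

open IsLocalRing

/-- The degree one part of the natural map `Gr_I(R) → Gr̄_I(R)`, that is, the map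
`λ_I : I / I ^ 2 → I^{(≥ 1)} / I^{(> 1)}` sending the class of `x` to the class of `x`. -/
noncomputable def lambdaMap {R : Type*} [CommRing R] (I : Ideal R) :
    I.Cotangent →ₗ[R] (geIdeal I 1) ⧸ (gtIdeal I 1).submoduleOf (geIdeal I 1) :=
  Ideal.Cotangent.lift
    (((gtIdeal I 1).submoduleOf (geIdeal I 1)).mkQ ∘ₗ Submodule.inclusion (le_geIdeal_one I))
    (fun x y => by
      rw [LinearMap.comp_apply, Submodule.mkQ_apply, Submodule.Quotient.mk_eq_zero]
      change ((x * y : I) : R) ∈ gtIdeal I 1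
      refine sq_le_gtIdeal_one I ?_
      rw [pow_two]
      exact Ideal.mul_mem_mul x.2 y.2)

variable (R : Type*) [CommRing R] [IsLocalRing R]

/-- The kernel of `λ_𝔪`, as a vector subspace of `𝔪 / 𝔪 ^ 2` over the residue field. -/
noncomputable def lambdaKer : Submodule (ResidueField R) (CotangentSpace R) where
  carrier := {x | lambdaMap (maximalIdeal R) x = 0}
  zero_mem' := map_zero _
  add_mem' {x y} hx hy := by
    simp only [Set.mem_ofPred_eq] at hx hy ⊢
    rw [map_add, hx, hy, add_zero]
  smul_mem' c x hx := by
    obtain ⟨r, rfl⟩ := residue_surjective c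
    simp only [Set.mem_ofPred_eq] at hx ⊢
    have h : (residue R r) • x = r • x := algebraMap_smul (ResidueField R) r x
    rw [h, map_smul, hx, smul_zero]

/-- The Krull dimension as a natural number (for rings of finite Krull dimension, such as
Noetherian local rings). -/
noncomputable def krullDim : ℕ := ((ringKrullDim R).unbotD 0).toNat

/-- The excess of embedding dimension `dim_k (𝔪 / 𝔪 ^ 2) - dim R` (which is nonnegative for a
Noetherian local ring). -/
noncomputable def excessEmbDim : ℕ :=
  Module.finrank (ResidueField R) (CotangentSpace R) - krullDim R

/-- The extremal case: the excess of embedding dimension `t` is positive and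
`dim ker λ_𝔪 = t`. -/
def IsExtremal : Prop :=
  0 < excessEmbDim R ∧ Module.finrank (ResidueField R) (lambdaKer R) = excessEmbDim R

/-- A sequence of elements of `𝔪` whose classes in `𝔪 / 𝔪 ^ 2` form a basis of `ker λ_𝔪`. -/
def IsLambdaSequence {t : ℕ} (γ : Fin t → R) : Prop :=
  ∃ h : ∀ i, γ i ∈ maximalIdeal R,
    LinearIndependent (ResidueField R)
      (fun i => ((maximalIdeal R).toCotangent ⟨γ i, h i⟩ : CotangentSpace R)) ∧
    Submodule.span (ResidueField R) (Set.range
      (fun i => ((maximalIdeal R).toCotangent ⟨γ i, h i⟩ : CotangentSpace R))) = lambdaKer R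

open Classical in
/-- The Samuel slope of a local ring with positive excess of embedding dimension: `1` in the
non-extremal case, and the supremum over all `λ_𝔪`-sequences of
`min {ν̄_𝔪(γ_1), …, ν̄_𝔪(γ_t)}` in the extremal case. -/
noncomputable def samuelSlope : ℝ≥0∞ :=
  if IsExtremal R then
    ⨆ (γ : Fin (excessEmbDim R) → R) (_ : IsLambdaSequence R γ),
      ⨅ i, asymptoticSamuel (maximalIdeal R) (γ i)
  else 1

/-- The (Hilbert–Samuel) multiplicity of the Noetherian local ring `R` at its maximal ideal is
`e`: `lim_{n → ∞} d! · length (R / 𝔪 ^ n) / n ^ d = e`, where `d = dim R`. -/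
def HasMultiplicity (e : ℕ) : Prop :=
  Tendsto (fun n : ℕ =>
    ((krullDim R)! : ℝ) * ((Module.length R (R ⧸ maximalIdeal R ^ n)).toNat : ℝ) /
      (n : ℝ) ^ krullDim R) atTop (𝓝 (e : ℝ))

/-- `R` is formally `d`-equidimensional: every irreducible component of the spectrum of the
`𝔪`-adic completion of `R` has dimension `d`. -/
def IsFormallyEquidimensional (d : ℕ) : Prop :=
  ∀ q ∈ minimalPrimes (AdicCompletion (maximalIdeal R) R),
    ringKrullDim (AdicCompletion (maximalIdeal R) R ⧸ q) = d

end LocalRing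

/-- `A → A'` is an étale homomorphism of local rings: `A'` is the localization of an étale
`A`-algebra `B` at a prime ideal lying over the maximal ideal of `A`. -/
def IsEtaleLocal.{u, v} (A : Type u) (A' : Type v) [CommRing A] [CommRing A'] [IsLocalRing A]
    [Algebra A A'] : Prop :=
  ∃ (B : Type u) (_ : CommRing B) (_ : Algebra A B) (_ : Algebra B A') (q : Ideal B)
    (_ : q.IsPrime), IsScalarTower A B A' ∧ Algebra.Etale A B ∧ IsLocalization.AtPrime A' q ∧
      q.comap (algebraMap A B) = IsLocalRing.maximalIdeal A

end SamuelSlope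

/-!
Let `b` be the minimum of the values `ν̄(γ'_i)` at the maximal ideal of `L = A'_{p'}`. Since the
classes of the `γ'_i` lie in the kernel of `λ`, `b > 1`. The proof finds an ideal `J ⊆ p` of `A` such
that `ν̄_p ≥ b` on `J` and all `γ'_i` lie in `J L`, and then takes the `γ_i` from `J`.
This gives both inequalities, because `ν̄` does not decrease under localization.

* *Linear algebra.* The images in `A_p` of the elements of `J` have classes in `ker λ`, which has
  dimension `t`. If they spanned less, `J L` modulo the square of the maximal ideal would be
  generated by fewer than `t` elements, while it contains the `t` independent classes of the `γ'_i`.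
  So they span `ker λ`, and a basis can be chosen among them
  (`exists_isLambdaSequence_of_mem_span`).

* *Étale descent.* As `L` is a localization of an étale algebra `B`, `p` generates its maximal
  ideal. An element `β` of `B` with `β ^ k ∈ p ^ M B` yields an element integral over the base change
  of a graded subalgebra of `A[X]`, the Rees algebra with weights `M / k`. Integral closure commutes
  with smooth base change, so `β` is a `B`-combination of elements `g` of `A` with `g X` integral
  over that Rees algebra, and these have `ν̄_p(g) ≥ M / k` (`mem_map_of_pow_mem_map_of_smooth`,
  `lt_asymptoticSamuel_of_isIntegral`). Hence, for every `c`, elements of `L` with `ν̄ > c` lie in the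
  extension to `L` of the ideal of elements of `A` with `ν̄_p > c`.

* *Left gaps.* If `b` is finite, the strict inequality is turned into `ν̄_p ≥ b` by the fact that the
  values of `ν̄_p` do not accumulate at `b` from below (`hasLeftGaps`): for a suitable `c < b`, the
  ideal of elements with `ν̄_p > c` serves as `J`. If `b` is infinite, the `γ'_i` are nilpotent in `L`
  (`isNilpotent_of_asymptoticSamuel_eq_top`), and `J` is the nilradical of `A`.

The absence of accumulation is proved without valuations. The extended Rees algebra reduces it to a
regular principal ideal `u S`, then to the localizations at the primes associated to `u S`, and
completion and passage to minimal primes lead to a complete local domain `T`. If `u T` is primary to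
the maximal ideal, the descending chain condition modulo a power of `u` suffices. Otherwise `T` is
replaced by its ideal transform `D`, which is a finite extension by Chevalley's theorem and the
Artin–Rees lemma; the primes associated to `u D` do not lie over the maximal ideal, so that their
heights are less than `dim T`, and induction on the dimension applies.
-/

namespace SamuelSlope

/-! ### Rees algebras with rational weights -/

section WeightedRees

open Polynomial
variable {R : Type*} [CommRing R]

/-- The graded subalgebra of `R[X]` whose part of degree `j` is `I ^ ⌈j M / k⌉`, the Rees algebra
of the filtration of `R` by the powers of `I` with exponent in `ℕ M / k`. The rounded exponent is
encoded by `N ≤ ⌈j M / k⌉ ↔ k N < j M + k`, which is valid for `k > 0`. -/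
def weightedRees (I : Ideal R) (M k : ℕ) : Subalgebra R R[X] where
  carrier := {f | ∀ j N : ℕ, k * N < j * M + k → f.coeff j ∈ I ^ N}
  mul_mem' {f g} hf hg j N hN := by
    rw [coeff_mul]
    refine sum_mem fun ij hij => ?_
    obtain ⟨i, j'⟩ := ij
    rw [Finset.HasAntidiagonal.mem_antidiagonal] at hij
    simp only at hij ⊢
    rcases Nat.eq_zero_or_pos k with rfl | hk
    · have h0 : i * M + j' * M = j * M := by rw [← add_mul, hij]
      rcases Nat.eq_zero_or_pos (i * M) with h | h
      · exact Ideal.mul_mem_left _ _ (hg j' N (by omega))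
      · exact Ideal.mul_mem_right _ _ (hf i N (by omega))
    -- the largest exponent allowed for `f.coeff i` is `⌈i * M / k⌉`
    set a := (i * M + k - 1) / k with ha
    have h1 : k * a + (i * M + k - 1) % k = i * M + k - 1 := Nat.div_add_mod _ _
    have h2 := Nat.mod_lt (i * M + k - 1) hk
    have hfa : f.coeff i ∈ I ^ a := hf i a (by omega)
    have h0 : i * M + j' * M = j * M := by rw [← add_mul, hij]
    rcases le_total N a with h | h
    · exact Ideal.mul_mem_right _ _ (Ideal.pow_le_pow_right h hfa)
    · obtain ⟨b, rfl⟩ := Nat.exists_eq_add_of_le h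
      rw [pow_add]
      refine Ideal.mul_mem_mul hfa (hg j' b ?_)
      rw [mul_add] at hN
      omega
  add_mem' hf hg j N hN := by
    rw [coeff_add]; exact add_mem (hf j N hN) (hg j N hN)
  algebraMap_mem' r j N hN := by
    rw [Polynomial.algebraMap_apply, coeff_C]
    split_ifs with h
    · subst h
      have : N = 0 := by
        by_contra h
        have : k * 1 ≤ k * N := Nat.mul_le_mul_left _ (Nat.one_le_iff_ne_zero.mpr h)
        omega
      simp [this]
    · exact zero_mem _

theorem monomial_mem_weightedRees {I : Ideal R} {M k : ℕ} {a : R} (ha : a ∈ I ^ M) :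
    monomial k a ∈ weightedRees I M k := by
  intro j N hN
  rw [coeff_monomial]
  split_ifs with h
  · subst h
    refine Ideal.pow_le_pow_right ?_ ha
    have : k * N < k * (M + 1) := by rw [mul_add]; omega
    exact Nat.lt_succ_iff.mp (lt_of_mul_lt_mul_left this (Nat.zero_le k))
  · exact zero_mem _

theorem monomial_coeff_mem_weightedRees {I : Ideal R} {M k : ℕ} {f : R[X]}
    (hf : f ∈ weightedRees I M k) (i : ℕ) : monomial i (f.coeff i) ∈ weightedRees I M k := by
  intro j N hN
  rw [coeff_monomial]
  split_ifs with h
  · subst h; exact hf _ N hN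
  · exact zero_mem _

/-- If `g X` satisfies an equation of degree `n` over `weightedRees I M k`, then the powers
`g ^ (n + l)` lie in `I ^ ⌈(l + 1) M / k⌉`: reduce `X ^ (n + l)` modulo the equation. -/
theorem exists_pow_mem_of_isIntegral {I : Ideal R} {M k : ℕ} {g : R}
    (h : IsIntegral (weightedRees I M k) (monomial 1 g : R[X])) :
    ∃ n : ℕ, ∀ l N : ℕ, k * N < (l + 1) * M + k → g ^ (n + l) ∈ I ^ N := by
  obtain ⟨p, hp, hp0⟩ := h
  nontriviality R
  have : Nontrivial (weightedRees I M k) := inferInstance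
  refine ⟨p.natDegree, fun l N hN => ?_⟩
  set q : (weightedRees I M k)[X] := X ^ (p.natDegree + l) %ₘ p with hq
  have h1 : (monomial 1 g : R[X]) ^ (p.natDegree + l) = aeval (monomial 1 g : R[X]) q := by
    rw [hq, aeval_modByMonic_eq_self_of_root (by simpa [aeval_def] using hp0)]
    simp
  by_cases hp1 : p = 1
  · subst hp1; simp at hp0
  have hdeg : q.natDegree < p.natDegree := natDegree_modByMonic_lt _ hp hp1
  have h2 : g ^ (p.natDegree + l) =
      ((monomial 1 g : R[X]) ^ (p.natDegree + l)).coeff (p.natDegree + l) := by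
    rw [monomial_pow, coeff_monomial]; simp
  rw [h2, h1, aeval_eq_sum_range, finsetSum_coeff]
  refine sum_mem fun i hi => ?_
  have hi' : i < p.natDegree := lt_of_le_of_lt (Nat.lt_succ_iff.mp (Finset.mem_range.mp hi)) hdeg
  rw [Algebra.smul_def, monomial_pow, one_mul]
  have : p.natDegree + l = (p.natDegree + l - i) + i := by omega
  rw [this, coeff_mul_monomial]
  refine Ideal.mul_mem_right _ _ ((q.coeff i).2 _ _ (lt_of_lt_of_le hN ?_))
  gcongr
  omega

/-- If `g X` is integral over `weightedRees I M k`, then `ν̄_I(g) ≥ M / k`. -/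
theorem lt_asymptoticSamuel_of_isIntegral {I : Ideal R} {M k : ℕ} (hk : 0 < k) {g : R}
    (h : IsIntegral (weightedRees I M k) (monomial 1 g : R[X])) {c : ℝ≥0}
    (hc : (c * k : ℝ) < M) : (c : ℝ≥0∞) < asymptoticSamuel I g := by
  obtain ⟨n, hn⟩ := exists_pow_mem_of_isIntegral h
  rw [coe_lt_asymptoticSamuel_iff]
  have hk' : (0 : ℝ) < k := by exact_mod_cast hk
  have hd : (0 : ℝ) < M - c * k := by linarith
  obtain ⟨l, hl⟩ := exists_nat_gt ((c : ℝ) * n * k / (M - c * k))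
  rw [div_lt_iff₀ hd] at hl
  have hl0 : 0 < l := by
    rcases Nat.eq_zero_or_pos l with rfl | h
    · simp only [Nat.cast_zero, zero_mul] at hl
      exact absurd hl (not_lt.mpr (by positivity))
    · exact h
  set N := (l * M + k - 1) / k with hN
  have h1 : k * N + (l * M + k - 1) % k = l * M + k - 1 := Nat.div_add_mod _ _
  have h2 := Nat.mod_lt (l * M + k - 1) hk
  refine ⟨n + l, N, by omega, hn l N (by rw [add_mul]; omega), ?_⟩
  have h3 : l * M ≤ k * N := by omega
  have h4 : (l * M : ℝ) ≤ k * N := by exact_mod_cast h3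
  push_cast
  have h5 : (c * (n + l) : ℝ) * k < N * k := by nlinarith
  exact lt_of_mul_lt_mul_right h5 hk'.le

theorem isIntegral_monomial_of_pow_mem {I : Ideal R} {M k : ℕ} (hk : 0 < k) {g : R}
    (h : IsIntegral (weightedRees I M k) (monomial k (g ^ k) : R[X])) :
    IsIntegral (weightedRees I M k) (monomial 1 g : R[X]) := by
  refine IsIntegral.of_pow hk ?_
  rwa [monomial_pow, one_mul]

attribute [local instance] Polynomial.algebra in
/-- The homogeneous parts of an element integral over the graded ring are integral. -/
theorem isIntegral_monomial_coeff {I : Ideal R} {M k : ℕ} {f : R[X]}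
    (hf : IsIntegral (weightedRees I M k) f) (i : ℕ) :
    IsIntegral (weightedRees I M k) (monomial i (f.coeff i) : R[X]) := by
  -- spread the homogeneous parts out along a second variable `Y`, by `X ↦ X * Y`
  set τ : R[X] →+* R[X][X] := eval₂RingHom (C.comp C) (C X * X) with hτ
  have hcoeff : ∀ (p : R[X]) (j : ℕ), (τ p).coeff j = monomial j (p.coeff j) := by
    intro p j
    induction p using Polynomial.induction_on' with
    | add p q hp hq => rw [map_add, coeff_add, hp, hq, coeff_add, map_add]
    | monomial n a =>
      simp only [hτ, coe_eval₂RingHom, eval₂_monomial, RingHom.comp_apply]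
      rw [mul_pow, ← C_pow, ← mul_assoc, ← C_mul, coeff_C_mul, coeff_X_pow, coeff_monomial]
      by_cases h : n = j
      · subst h; simp [C_mul_X_pow_eq_monomial]
      · rw [if_neg h, if_neg (fun h' => h h'.symm)]; simp
  suffices h : IsIntegral (weightedRees I M k)[X] (τ f) by
    have := Polynomial.isIntegral_iff_isIntegral_coeff.mp h i
    rwa [hcoeff] at this
  obtain ⟨p, hp, hp0⟩ := hf
  set ψ : weightedRees I M k →+* R[X][X] := τ.comp (algebraMap (weightedRees I M k) R[X]) with hψ
  have hl : p.map ψ ∈ lifts (algebraMap (weightedRees I M k)[X] R[X][X]) := by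
    rw [lifts_iff_coeff_lifts]
    intro n
    rw [coeff_map]
    have : ψ (p.coeff n) ∈ lifts (algebraMap (weightedRees I M k) R[X]) := by
      rw [lifts_iff_coeff_lifts]
      intro j
      rw [hψ, RingHom.comp_apply, hcoeff]
      exact ⟨⟨_, monomial_coeff_mem_weightedRees (p.coeff n).2 j⟩, rfl⟩
    rwa [mem_lifts] at this
  obtain ⟨q, hq, -, hqm⟩ := lifts_and_natDegree_eq_and_monic hl (hp.map ψ)
  refine ⟨q, hqm, ?_⟩
  rw [← eval_map, hq, eval_map, hψ, ← hom_eval₂, hp0, map_zero]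

end WeightedRees

/-! ### Left gaps of the asymptotic Samuel function -/

section LeftGaps

open Polynomial

theorem asymptoticSamuel_le_of_map_le {R S : Type*} [CommRing R] [CommRing S] (f : R →+* S)
    {I : Ideal R} {J : Ideal S} (h : I.map f ≤ J) (g : R) :
    asymptoticSamuel I g ≤ asymptoticSamuel J (f g) := by
  refine ENNReal.le_of_forall_nnreal_lt fun c hc => ?_
  obtain ⟨k, M, hk, hM, hc'⟩ := (coe_lt_asymptoticSamuel_iff I).mp hc
  refine ((coe_lt_asymptoticSamuel_iff J).mpr ⟨k, M, hk, ?_, hc'⟩).le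
  rw [← map_pow]
  refine Ideal.pow_right_mono h M ?_
  rw [← Ideal.map_pow]
  exact Ideal.mem_map_of_mem f hM

variable {R : Type*} [CommRing R] (I : Ideal R)

/-- The values of `ν̄_I` do not accumulate at any positive real number from the left. -/
def HasLeftGaps : Prop :=
  ∀ b : ℝ≥0, 0 < b → ∃ c < b, ∀ g : R, (c : ℝ≥0∞) < asymptoticSamuel I g →
    (b : ℝ≥0∞) ≤ asymptoticSamuel I g

variable {I}

theorem le_asymptoticSamuel_iff_forall_lt {g : R} {b : ℝ≥0} :
    (b : ℝ≥0∞) ≤ asymptoticSamuel I g ↔ ∀ c < b, (c : ℝ≥0∞) < asymptoticSamuel I g := by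
  constructor
  · intro h c hc
    exact lt_of_lt_of_le (ENNReal.coe_lt_coe.mpr hc) h
  · intro h
    refine le_of_forall_lt fun c hc => ?_
    lift c to ℝ≥0 using hc.ne_top
    exact h c (ENNReal.coe_lt_coe.mp hc)

/-- Left gaps pass from a finite family of functions `ν̄` to their minimum. -/
theorem hasLeftGaps_of_finite_family {ι : Type*} [Finite ι] {S : ι → Type*}
    [∀ i, CommRing (S i)] (f : ∀ i, R →+* S i) (J : ∀ i, Ideal (S i))
    (h : ∀ (g : R) (c : ℝ≥0), (∀ i, (c : ℝ≥0∞) < asymptoticSamuel (J i) (f i g)) ↔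
      (c : ℝ≥0∞) < asymptoticSamuel I g)
    (hJ : ∀ i, HasLeftGaps (J i)) : HasLeftGaps I := by
  intro b hb
  have := Fintype.ofFinite ι
  choose c hc hcb using fun i => hJ i b hb
  refine ⟨Finset.univ.sup c, ?_, fun g hg => ?_⟩
  · rw [Finset.sup_lt_iff (by simpa using hb)]
    exact fun i _ => hc i
  · rw [le_asymptoticSamuel_iff_forall_lt]
    intro a ha
    rw [← h]
    intro i
    refine lt_of_lt_of_le (ENNReal.coe_lt_coe.mpr ha) (hcb i _ ?_)
    refine lt_of_le_of_lt ?_ ((h g _).mpr hg i)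
    exact ENNReal.coe_le_coe.mpr (Finset.le_sup (Finset.mem_univ i))

theorem hasLeftGaps_of_pow_mem_iff {S : Type*} [CommRing S] (f : R →+* S) {J : Ideal S}
    (h : ∀ (M : ℕ) (g : R), f g ∈ J ^ M ↔ g ∈ I ^ M) (hJ : HasLeftGaps J) : HasLeftGaps I := by
  refine hasLeftGaps_of_finite_family (ι := Unit) (fun _ => f) (fun _ => J) (fun g c => ?_)
    fun _ => hJ
  simp only [forall_const, coe_lt_asymptoticSamuel_iff, ← map_pow, h]

theorem exists_forall_pow_mul_mem {g : R} {c : ℝ≥0} (h : (c : ℝ≥0∞) < asymptoticSamuel I g) :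
    ∃ k > 0, ∀ l > 0, g ^ (k * l) ∈ I ^ (⌊(c * (k * l : ℕ) : ℝ)⌋₊ + 1) := by
  obtain ⟨k, M, hk, hM, hc⟩ := (coe_lt_asymptoticSamuel_iff I).mp h
  refine ⟨k, hk, fun l hl => ?_⟩
  rw [pow_mul]
  refine Ideal.pow_le_pow_right ?_ (by rw [pow_mul]; exact Ideal.pow_mem_pow hM l :
    (g ^ k) ^ l ∈ I ^ (M * l))
  rw [Nat.add_one_le_iff, Nat.floor_lt (by positivity)]
  push_cast
  have : (0 : ℝ) < l := by exact_mod_cast hl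
  nlinarith

/-- Finitely many strict lower bounds for `ν̄` are witnessed by one common exponent. -/
theorem exists_common_pow_mem {ι : Type*} [Finite ι] {S : ι → Type*}
    [∀ i, CommRing (S i)] (f : ∀ i, R →+* S i) (J : ∀ i, Ideal (S i)) {g : R} {c : ℝ≥0}
    (h : ∀ i, (c : ℝ≥0∞) < asymptoticSamuel (J i) (f i g)) :
    ∃ k M : ℕ, 0 < k ∧ (c * k : ℝ) < M ∧ ∀ i, f i (g ^ k) ∈ J i ^ M := by
  have := Fintype.ofFinite ι
  classical
  choose k hk hkl using fun i => exists_forall_pow_mul_mem (h i)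
  have hK : 0 < ∏ i, k i := Finset.prod_pos fun i _ => hk i
  refine ⟨∏ i, k i, ⌊(c * (∏ i, k i : ℕ) : ℝ)⌋₊ + 1, hK, ?_, fun i => ?_⟩
  · push_cast
    exact_mod_cast Nat.lt_floor_add_one _
  · obtain ⟨l, hl⟩ := Finset.dvd_prod_of_mem k (Finset.mem_univ i)
    have hl0 : 0 < l := Nat.pos_of_ne_zero fun h0 => by simp [hl, h0] at hK
    have := hkl i l hl0
    rw [← hl] at this
    rwa [map_pow]

theorem lt_asymptoticSamuel_of_pow_isIntegral {M k : ℕ} (hk : 0 < k) {g : R}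
    (h : IsIntegral (weightedRees I M k) (monomial k (g ^ k) : R[X])) {c : ℝ≥0}
    (hc : (c * k : ℝ) < M) : (c : ℝ≥0∞) < asymptoticSamuel I g :=
  lt_asymptoticSamuel_of_isIntegral hk (isIntegral_monomial_of_pow_mem hk h) hc

/-- `ν̄_I` is the minimum of the functions `ν̄` induced on the quotients by the minimal primes:
if `x - a_q ∈ q` for all `q`, the product of these differences is nilpotent, which is an equation
of integral dependence for `x`. -/
theorem forall_minimalPrimes_lt_asymptoticSamuel_iff [IsNoetherianRing R] (g : R) (c : ℝ≥0) :
    (∀ q : minimalPrimes R, (c : ℝ≥0∞) <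
      asymptoticSamuel (I.map (Ideal.Quotient.mk q.1)) (Ideal.Quotient.mk q.1 g)) ↔
      (c : ℝ≥0∞) < asymptoticSamuel I g := by
  refine ⟨fun h => ?_, fun h q => h.trans_le (asymptoticSamuel_le_of_map_le _ le_rfl g)⟩
  have : Finite (minimalPrimes R) := (minimalPrimes.finite_of_isNoetherianRing R)
  have := Fintype.ofFinite (minimalPrimes R)
  obtain ⟨k, M, hk, hc, hM⟩ := exists_common_pow_mem
    (fun q : minimalPrimes R => Ideal.Quotient.mk q.1) (fun q => I.map (Ideal.Quotient.mk q.1)) h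
  have hex : ∀ q : minimalPrimes R, ∃ a ∈ I ^ M, g ^ k - a ∈ q.1 := by
    intro q
    have := hM q
    rw [← Ideal.map_pow, Ideal.mem_map_iff_of_surjective _ Ideal.Quotient.mk_surjective] at this
    obtain ⟨a, ha, haq⟩ := this
    exact ⟨a, ha, Ideal.Quotient.eq.mp haq.symm⟩
  choose a ha haq using hex
  have hnil : IsNilpotent (∏ q, (g ^ k - a q)) := by
    rw [nilpotent_iff_mem_prime]
    intro J hJ
    obtain ⟨q, hq, hqJ⟩ := Ideal.exists_minimalPrimes_le (bot_le : (⊥ : Ideal R) ≤ J)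
    exact hqJ (Ideal.mem_of_dvd _ (Finset.dvd_prod_of_mem _ (Finset.mem_univ ⟨q, hq⟩))
      (haq ⟨q, hq⟩))
  obtain ⟨e, he⟩ := hnil
  refine lt_asymptoticSamuel_of_pow_isIntegral hk ?_ hc
  refine ⟨(∏ q, (X - C ⟨monomial k (a q), monomial_mem_weightedRees (ha q)⟩)) ^ e,
    (monic_prod_of_monic _ _ fun q _ => monic_X_sub_C _).pow e, ?_⟩
  rw [eval₂_pow, eval₂_finsetProd]
  simp only [eval₂_sub, eval₂_X, eval₂_C, Subalgebra.algebraMap_def,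
    Algebra.algebraMap_self, RingHom.id_apply]
  have hprod : ∀ s : Finset (minimalPrimes R), ∏ q ∈ s, monomial k (g ^ k - a q) =
      monomial (s.card * k) (∏ q ∈ s, (g ^ k - a q)) := by
    classical
    intro s
    induction s using Finset.induction_on with
    | empty => simp
    | insert q s hq ih =>
      rw [Finset.prod_insert hq, ih, monomial_mul_monomial, Finset.prod_insert hq,
        Finset.card_insert_of_notMem hq, add_mul, one_mul, add_comm]
  simp only [map_sub] at hprod
  rw [hprod, monomial_pow, he, map_zero]

/-- `ν̄` is unchanged under integral extensions: one inequality; the other one is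
`asymptoticSamuel_le_of_map_le`. -/
theorem lt_asymptoticSamuel_of_isIntegral_algebra {D : Type*} [CommRing D] [Algebra R D]
    [Algebra.IsIntegral R D] (hinj : Function.Injective (algebraMap R D)) {g : R} {c : ℝ≥0}
    (h : (c : ℝ≥0∞) < asymptoticSamuel (I.map (algebraMap R D)) (algebraMap R D g)) :
    (c : ℝ≥0∞) < asymptoticSamuel I g := by
  obtain ⟨k, M, hk, hM, hc⟩ := (coe_lt_asymptoticSamuel_iff _).mp h
  refine lt_asymptoticSamuel_of_pow_isIntegral hk ?_ hc
  set θ : R[X] →+* D[X] := mapRingHom (algebraMap R D) with hθ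
  have hθi : Function.Injective θ := map_injective _ hinj
  set ψ : weightedRees I M k →+* D[X] := θ.comp (algebraMap _ R[X]) with hψ
  suffices hs : ψ.IsIntegralElem (θ (monomial k (g ^ k))) by
    obtain ⟨p, hp, hp0⟩ := hs
    refine ⟨p, hp, hθi ?_⟩
    rw [hom_eval₂, map_zero]
    exact hp0
  have hθm : θ (monomial k (g ^ k)) = monomial k (algebraMap R D g ^ k) := by
    simp [hθ]
  rw [hθm]
  rw [← Ideal.map_pow] at hM
  refine Submodule.span_induction (p := fun x _ => ψ.IsIntegralElem (monomial k x)) ?_ ?_ ?_ ?_ hM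
  · rintro _ ⟨a, ha, rfl⟩
    have : monomial k (algebraMap R D a) = ψ ⟨monomial k a, monomial_mem_weightedRees ha⟩ := by
      simp [hψ, hθ]
    rw [this]
    exact ψ.isIntegralElem_map
  · simpa using ψ.isIntegralElem_zero
  · intro x y _ _ hx hy
    rw [map_add]; exact hx.add ψ hy
  · intro d x _ hx
    have : monomial k (d • x) = C d * monomial k x := by simp [C_mul_monomial]
    rw [this]
    refine RingHom.IsIntegralElem.mul ψ ?_ hx
    obtain ⟨p, hp, hp0⟩ := Algebra.IsIntegral.isIntegral (R := R) d
    refine ⟨p.map (algebraMap R (weightedRees I M k)), hp.map _, ?_⟩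
    rw [eval₂_map]
    have : ψ.comp (algebraMap R (weightedRees I M k)) = C.comp (algebraMap R D) := by
      ext x
      simp [hψ, hθ]
    rw [this, ← hom_eval₂, hp0, map_zero]

theorem hasLeftGaps_of_isIntegral_algebra {D : Type*} [CommRing D] [Algebra R D]
    [Algebra.IsIntegral R D] (hinj : Function.Injective (algebraMap R D))
    (h : HasLeftGaps (I.map (algebraMap R D))) : HasLeftGaps I :=
  hasLeftGaps_of_finite_family (ι := Unit) (fun _ => algebraMap R D)
    (fun _ => I.map (algebraMap R D)) (fun g _ => ⟨fun h =>
      lt_asymptoticSamuel_of_isIntegral_algebra hinj (h ()),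
      fun h _ => h.trans_le (asymptoticSamuel_le_of_map_le _ le_rfl g)⟩) fun _ => h

theorem hasLeftGaps_of_minimalPrimes [IsNoetherianRing R]
    (h : ∀ q ∈ minimalPrimes R, HasLeftGaps (I.map (Ideal.Quotient.mk q))) : HasLeftGaps I :=
  have : Finite (minimalPrimes R) := (minimalPrimes.finite_of_isNoetherianRing R)
  hasLeftGaps_of_finite_family (fun q : minimalPrimes R => Ideal.Quotient.mk q.1)
    (fun q => I.map (Ideal.Quotient.mk q.1)) forall_minimalPrimes_lt_asymptoticSamuel_iff
    fun q => h q.1 q.2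

end LeftGaps

/-! ### Regular principal ideals and extended Rees algebras -/

section AssociatedPrimes

variable {S : Type*} [CommRing S] [IsNoetherianRing S] {u : S}

/-- Membership in a power of a regular principal ideal `u S` can be tested at the finitely many
primes associated to `u S`, the same ones for all powers. -/
theorem mem_span_pow_of_forall_associatedPrimes (hu : u ∈ nonZeroDivisors S) (M : ℕ) (g : S)
    (h : ∀ Q : associatedPrimes S (S ⧸ Ideal.span {u}),
      algebraMap S (Localization.AtPrime Q.1) g ∈
        (Ideal.span {u}).map (algebraMap S (Localization.AtPrime Q.1)) ^ M) :
    g ∈ Ideal.span {u} ^ M := by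
  induction M with
  | zero => simp
  | succ M ih =>
    have hg := ih fun Q => Ideal.pow_le_pow_right M.le_succ (h Q)
    rw [Ideal.span_singleton_pow, Ideal.mem_span_singleton] at hg ⊢
    obtain ⟨x, rfl⟩ := hg
    rw [pow_succ]
    refine mul_dvd_mul_left _ ?_
    by_contra hx
    have hx0 : (Ideal.Quotient.mk (Ideal.span {u}) x) ≠ 0 := by
      rwa [Ne, Ideal.Quotient.eq_zero_iff_mem, Ideal.mem_span_singleton]
    obtain ⟨Q, hQ, hxQ⟩ := exists_le_isAssociatedPrime_of_isNoetherianRing S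
      (Ideal.Quotient.mk (Ideal.span {u}) x) hx0
    have hQp : Q.IsPrime := hQ.isPrime
    have := h ⟨Q, hQ⟩
    rw [Ideal.map_span, Set.image_singleton, Ideal.span_singleton_pow,
      Ideal.mem_span_singleton, map_mul, map_pow, pow_succ] at this
    have hreg : IsLeftRegular (algebraMap S (Localization.AtPrime Q) u ^ M) := by
      rw [← map_pow]
      exact (IsLocalization.map_nonZeroDivisors_le Q.primeCompl _
        ⟨_, pow_mem hu M, rfl⟩ : _ ∈ nonZeroDivisors (Localization.AtPrime Q)) |>.1 |> fun h =>
          isLeftRegular_iff_right_eq_zero_of_mul.mpr h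
    obtain ⟨y, hy⟩ := this
    rw [mul_assoc] at hy
    have hy' := hreg hy
    obtain ⟨⟨a, s⟩, hs⟩ := IsLocalization.surj Q.primeCompl y
    simp only at hs
    have : algebraMap S (Localization.AtPrime Q) (x * s) = algebraMap S _ (u * a) := by
      rw [map_mul, map_mul, hy', mul_assoc, hs]
    obtain ⟨s', hs'⟩ := (IsLocalization.eq_iff_exists Q.primeCompl _).mp this
    have hmem : (s' : S) * s ∈ Q := by
      apply hxQ
      rw [Submodule.mem_colon_singleton]
      change ((s' : S) * s) • Ideal.Quotient.mk (Ideal.span {u}) x ∈ _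
      rw [Submodule.mem_bot, Algebra.smul_def, Ideal.Quotient.algebraMap_eq, ← map_mul,
        Ideal.Quotient.eq_zero_iff_mem, Ideal.mem_span_singleton]
      exact ⟨s' * a, by linear_combination hs'⟩
    rcases hQp.mem_or_mem hmem with h | h
    · exact s'.2 h
    · exact s.2 h

theorem hasLeftGaps_of_associatedPrimes (hu : u ∈ nonZeroDivisors S)
    (h : ∀ Q : associatedPrimes S (S ⧸ Ideal.span {u}),
      HasLeftGaps ((Ideal.span {u}).map (algebraMap S (Localization.AtPrime Q.1)))) :
    HasLeftGaps (Ideal.span {u}) := by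
  have : Finite (associatedPrimes S (S ⧸ Ideal.span {u})) := associatedPrimes.finite S _
  refine hasLeftGaps_of_finite_family
    (fun Q : associatedPrimes S (S ⧸ Ideal.span {u}) => algebraMap S (Localization.AtPrime Q.1))
    _ (fun g c => ⟨fun hc => ?_, fun hc Q => ?_⟩) h
  · obtain ⟨k, M, hk, hc', hM⟩ := exists_common_pow_mem _ _ hc
    exact (coe_lt_asymptoticSamuel_iff _).mpr
      ⟨k, M, hk, mem_span_pow_of_forall_associatedPrimes hu M _ hM, hc'⟩
  · exact hc.trans_le (asymptoticSamuel_le_of_map_le _ le_rfl g)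

end AssociatedPrimes

section ExtendedRees

open Polynomial LaurentPolynomial
variable {R : Type*} [CommRing R] (I : Ideal R)

/-- The Rees algebra `⨁ Iⁿ Xⁿ` as a ring of its own: the type is not reducible to the subalgebra of
`R[X]`, which keeps instance search away from the coefficient ring. -/
def ReesRing : Type _ := reesAlgebra I

noncomputable instance : CommRing (ReesRing I) := inferInstanceAs (CommRing (reesAlgebra I))

instance [IsNoetherianRing R] : IsNoetherianRing (ReesRing I) :=
  inferInstanceAs (IsNoetherianRing (reesAlgebra I))

/-- The inclusion of the Rees algebra into `R[X]`. -/
noncomputable def reesRingVal : ReesRing I →+* R[X] := (reesAlgebra I).val.toRingHom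

/-- The inclusion of `R` as the part of degree zero of the Rees algebra. -/
noncomputable def toReesRing : R →+* ReesRing I := algebraMap R (reesAlgebra I)

theorem reesRingVal_coeff_mem (f : ReesRing I) (n : ℕ) : (reesRingVal I f).coeff n ∈ I ^ n :=
  f.2 n

theorem reesRingVal_toReesRing (g : R) : reesRingVal I (toReesRing I g) = Polynomial.C g := rfl

theorem exists_reesRingVal_eq_monomial {g : R} {n : ℕ} (hg : g ∈ I ^ n) :
    ∃ f : ReesRing I, reesRingVal I f = monomial n g :=
  ⟨⟨monomial n g, reesAlgebra.monomial_mem.mpr hg⟩, rfl⟩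

/-- The map from polynomials over the Rees algebra to Laurent polynomials which sends the variable
to `T⁻¹`. -/
noncomputable def extendedReesHom : (ReesRing I)[X] →+* R[T;T⁻¹] :=
  eval₂RingHom (Polynomial.toLaurent.comp (reesRingVal I)) (T (-1))

/-- The extended Rees algebra `R[I T, T⁻¹]`, the image of `extendedReesHom`. It is encoded as a
quotient of a polynomial ring over the Rees algebra, which makes it Noetherian by construction. -/
def ExtendedRees : Type _ := (ReesRing I)[X] ⧸ RingHom.ker (extendedReesHom I)

noncomputable instance : CommRing (ExtendedRees I) :=
  inferInstanceAs (CommRing ((ReesRing I)[X] ⧸ RingHom.ker (extendedReesHom I)))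

instance [IsNoetherianRing R] : IsNoetherianRing (ExtendedRees I) :=
  inferInstanceAs (IsNoetherianRing ((ReesRing I)[X] ⧸ RingHom.ker (extendedReesHom I)))

instance [IsDomain R] : IsDomain (ExtendedRees I) :=
  have := RingHom.ker_isPrime (extendedReesHom I)
  inferInstanceAs (IsDomain ((ReesRing I)[X] ⧸ RingHom.ker (extendedReesHom I)))

/-- The quotient map onto the extended Rees algebra. -/
noncomputable def extendedReesMk : (ReesRing I)[X] →+* ExtendedRees I :=
  Ideal.Quotient.mk (RingHom.ker (extendedReesHom I))

theorem extendedReesMk_surjective : Function.Surjective (extendedReesMk I) :=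
  Ideal.Quotient.mk_surjective

theorem extendedReesMk_eq_iff (p q : (ReesRing I)[X]) :
    extendedReesMk I p = extendedReesMk I q ↔ extendedReesHom I p = extendedReesHom I q := by
  rw [← sub_eq_zero (b := extendedReesHom I q), ← map_sub, ← RingHom.mem_ker]
  exact Ideal.Quotient.eq

theorem extendedReesHom_C (f : ReesRing I) :
    extendedReesHom I (Polynomial.C f) = Polynomial.toLaurent (reesRingVal I f) := by
  simp [extendedReesHom]

theorem extendedReesHom_X : extendedReesHom I X = T (-1) := by
  simp [extendedReesHom]

theorem coeff_extendedReesHom_mem (f : (ReesRing I)[X]) (M : ℕ) :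
    (extendedReesHom I f).coeff (M : ℤ) ∈ I ^ M := by
  induction f using Polynomial.induction_on' with
  | add p q hp hq => rw [map_add]; exact add_mem hp hq
  | monomial n a =>
    rw [← Polynomial.C_mul_X_pow_eq_monomial, map_mul, map_pow, extendedReesHom_C,
      extendedReesHom_X, T_pow]
    have : (Polynomial.toLaurent (reesRingVal I a) * T (n * -1)).coeff (M : ℤ) =
        (reesRingVal I a).coeff (M + n) := by
      have h := AddMonoidAlgebra.coeff_mul_single_apply (Polynomial.toLaurent (reesRingVal I a))
        (1 : R) (n * -1 : ℤ) (M : ℤ)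
      rw [mul_one] at h
      refine h.trans ?_
      have h2 : (M : ℤ) + -(n * -1 : ℤ) = ((M + n : ℕ) : ℤ) := by push_cast; ring
      rw [h2, coeff_toLaurent]
      exact Finsupp.mapDomain_apply Nat.castEmbedding.injective _ _
    rw [this]
    exact Ideal.pow_le_pow_right (Nat.le_add_right M n) (reesRingVal_coeff_mem I a (M + n))

/-- The element `T⁻¹` of the extended Rees algebra. -/
noncomputable def extendedReesParam : ExtendedRees I :=
  extendedReesMk I X

/-- The inclusion of `R` as the part of degree zero of the extended Rees algebra. -/
noncomputable def toExtendedRees : R →+* ExtendedRees I :=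
  (extendedReesMk I).comp (Polynomial.C.comp (toReesRing I))

/-- The powers of `I` are contracted from the powers of the regular principal ideal generated by
`T⁻¹`, so that `ν̄_I` is the restriction of the function `ν̄` of a principal ideal. -/
theorem toExtendedRees_mem_iff (M : ℕ) (g : R) :
    toExtendedRees I g ∈ Ideal.span {extendedReesParam I} ^ M ↔ g ∈ I ^ M := by
  have hC : extendedReesHom I (Polynomial.C (toReesRing I g)) =
      LaurentPolynomial.C g := by
    rw [extendedReesHom_C, reesRingVal_toReesRing, Polynomial.toLaurent_C]
  have hT : (T (-1) : R[T;T⁻¹]) ^ M * T M = 1 := by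
    rw [T_pow, ← T_add, mul_neg_one, neg_add_cancel, T_zero]
  rw [Ideal.span_singleton_pow, Ideal.mem_span_singleton]
  constructor
  · rintro ⟨y, hy⟩
    obtain ⟨q, rfl⟩ := extendedReesMk_surjective I y
    rw [toExtendedRees, RingHom.comp_apply, extendedReesParam, ← map_pow, ← map_mul,
      extendedReesMk_eq_iff, RingHom.comp_apply, hC, map_mul,
      map_pow, extendedReesHom_X] at hy
    have h1 : LaurentPolynomial.C g * T M = extendedReesHom I q := by
      rw [hy, mul_right_comm, hT, one_mul]
    have h2 := coeff_extendedReesHom_mem I q M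
    rwa [← h1, ← single_eq_C_mul_T, AddMonoidAlgebra.coeff_single, Finsupp.single_eq_same] at h2
  · intro hg
    obtain ⟨f, hf⟩ := exists_reesRingVal_eq_monomial I hg
    refine ⟨extendedReesMk I (Polynomial.C f), ?_⟩
    rw [toExtendedRees, RingHom.comp_apply, extendedReesParam, ← map_pow, ← map_mul,
      extendedReesMk_eq_iff, RingHom.comp_apply, hC, map_mul,
      map_pow, extendedReesHom_X, extendedReesHom_C, hf, ← Polynomial.C_mul_X_pow_eq_monomial,
      Polynomial.toLaurent_C_mul_X_pow, mul_left_comm, hT, mul_one]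

theorem extendedReesParam_mem_nonZeroDivisors :
    extendedReesParam I ∈ nonZeroDivisors (ExtendedRees I) := by
  rw [mem_nonZeroDivisors_iff_right]
  intro y hy
  obtain ⟨q, rfl⟩ := extendedReesMk_surjective I y
  rw [extendedReesParam, ← map_mul, ← map_zero (extendedReesMk I), extendedReesMk_eq_iff, map_mul,
    extendedReesHom_X, map_zero] at hy
  rw [← map_zero (extendedReesMk I), extendedReesMk_eq_iff, map_zero]
  exact (isUnit_T (-1)).mul_left_eq_zero.mp hy

theorem not_isUnit_extendedReesParam (hI : I ≠ ⊤) : ¬ IsUnit (extendedReesParam I) := by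
  intro h
  refine hI ((Ideal.eq_top_iff_one I).mpr ?_)
  have := toExtendedRees_mem_iff I 1 1
  rw [pow_one I] at this
  rw [← this, pow_one, Ideal.span_singleton_eq_top.mpr h]
  trivial

theorem toExtendedRees_injective : Function.Injective (toExtendedRees I) := by
  rw [injective_iff_map_eq_zero]
  intro g hg
  rw [toExtendedRees, RingHom.comp_apply, ← map_zero (extendedReesMk I), extendedReesMk_eq_iff,
    map_zero, RingHom.comp_apply, extendedReesHom_C, reesRingVal_toReesRing,
    Polynomial.toLaurent_eq_zero, Polynomial.C_eq_zero] at hg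
  exact hg

/-- An element `g` of a Noetherian domain with `ν̄_I(g) = ∞` for a proper ideal `I` vanishes. Let `u`
be the parameter of the extended Rees algebra and `P` a minimal prime over it, which has height one.
At `P` some power `u ^ e` is divisible by `g ≠ 0`, while some `g ^ k` is divisible by `u ^ M` with
`M > e k`, so that `u` would be a unit. -/
theorem eq_zero_of_asymptoticSamuel_eq_top_of_isDomain [IsDomain R] [IsNoetherianRing R]
    (hI : I ≠ ⊤) {g : R} (hg : asymptoticSamuel I g = ∞) : g = 0 := by
  by_contra hg0
  let u := extendedReesParam I
  let x := toExtendedRees I g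
  have hx0 : x ≠ 0 := fun h => hg0 (toExtendedRees_injective I (by rw [map_zero]; exact h))
  have hu0 : u ≠ 0 := nonZeroDivisors.ne_zero (extendedReesParam_mem_nonZeroDivisors I)
  have hne : Ideal.span {u} ≠ ⊤ := by
    rw [Ne, Ideal.span_singleton_eq_top]; exact not_isUnit_extendedReesParam I hI
  obtain ⟨P, hP⟩ := Ideal.nonempty_minimalPrimes hne
  have hPp : P.IsPrime := hP.1.1
  have hht : P.height ≤ 1 := Ideal.height_le_one_of_isPrincipal_of_mem_minimalPrimes _ _ hP
  set W := Localization.AtPrime P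
  have huP : u ∈ P := hP.1.2 (Ideal.mem_span_singleton_self u)
  have hinj : Function.Injective (algebraMap (ExtendedRees I) W) :=
    IsLocalization.injective W P.primeCompl_le_nonZeroDivisors
  obtain ⟨e, he⟩ : ∃ e : ℕ, algebraMap _ W x ∣ algebraMap _ W u ^ e := by
    -- every prime of `W` containing `x` is nonzero, hence equal to the maximal ideal
    have hrad : algebraMap _ W u ∈ (Ideal.span {algebraMap _ W x}).radical := by
      rw [Ideal.radical_eq_sInf, Ideal.mem_sInf]
      rintro J ⟨hJ, hJp⟩
      have hJx : x ∈ J.comap (algebraMap (ExtendedRees I) W) :=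
        hJ (Ideal.mem_span_singleton_self _)
      have hJP : J.comap (algebraMap (ExtendedRees I) W) ≤ P := by
        have := Ideal.comap_mono (f := algebraMap (ExtendedRees I) W)
          (IsLocalRing.le_maximalIdeal hJp.ne_top)
        exact this.trans (IsLocalization.AtPrime.under_maximalIdeal W P).le
      have hJc : (J.comap (algebraMap (ExtendedRees I) W)).IsPrime := hJp.comap _
      rcases hJP.eq_or_lt with h | h
      · exact Ideal.mem_comap.mp (h.symm ▸ huP)
      · exfalso
        have h1 := (Ideal.height_add_one_le_of_lt_of_isPrime h).trans hht
        have h2 : (J.comap (algebraMap (ExtendedRees I) W)).height = 0 := by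
          rcases eq_or_ne (J.comap (algebraMap (ExtendedRees I) W)).height 0 with h0 | h0
          · exact h0
          · have h3 := Order.one_le_iff_pos.mpr (pos_iff_ne_zero.mpr h0)
            exact absurd ((add_le_add_left h3 1).trans h1) (by norm_num)
        rw [Ideal.height_eq_zero_iff_eq_bot] at h2
        rw [h2] at hJx
        exact hx0 hJx
    obtain ⟨e, he⟩ := hrad
    exact ⟨e, Ideal.mem_span_singleton.mp he⟩
  have hlt : ((e : ℝ≥0) : ℝ≥0∞) < asymptoticSamuel I g := by rw [hg]; exact ENNReal.coe_lt_top
  obtain ⟨k, M, hk, hM, hc⟩ := (coe_lt_asymptoticSamuel_iff I).mp hlt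
  have hc' : e * k < M := by exact_mod_cast hc
  rw [← toExtendedRees_mem_iff, Ideal.span_singleton_pow, Ideal.mem_span_singleton, map_pow] at hM
  have h1 : algebraMap _ W u ^ M ∣ algebraMap _ W u ^ (e * k) := by
    rw [pow_mul]
    refine dvd_trans ?_ (pow_dvd_pow_of_dvd he k)
    rw [← map_pow, ← map_pow]
    exact map_dvd _ hM
  have h2 : algebraMap _ W u ≠ 0 := by
    rwa [Ne, map_eq_zero_iff _ hinj]
  have h3 : IsUnit (algebraMap _ W u) := by
    obtain ⟨y, hy⟩ := h1
    obtain ⟨j, rfl⟩ := Nat.exists_eq_add_of_lt hc'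
    rw [add_assoc, pow_add, mul_assoc] at hy
    have h4 := mul_left_cancel₀ (pow_ne_zero (e * k) h2) ((mul_one _).trans hy)
    rw [pow_succ', mul_assoc] at h4
    exact IsUnit.of_mul_eq_one _ h4.symm
  exact (IsLocalization.AtPrime.isUnit_to_map_iff W P u).mp h3 huP

end ExtendedRees

section Reductions

variable {R : Type*} [CommRing R]

theorem hasLeftGaps_of_extendedRees (I : Ideal R)
    (h : HasLeftGaps (Ideal.span {extendedReesParam I})) : HasLeftGaps I :=
  hasLeftGaps_of_pow_mem_iff (toExtendedRees I) (toExtendedRees_mem_iff I) h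

/-- In a Noetherian local ring, `ν̄_I` is infinite only on nilpotent elements. -/
theorem isNilpotent_of_asymptoticSamuel_eq_top [IsNoetherianRing R] [IsLocalRing R] {I : Ideal R}
    (hI : I ≠ ⊤) {g : R} (hg : asymptoticSamuel I g = ∞) : IsNilpotent g := by
  rw [nilpotent_iff_mem_prime]
  intro J hJ
  rw [← Ideal.Quotient.eq_zero_iff_mem]
  refine eq_zero_of_asymptoticSamuel_eq_top_of_isDomain (I := I.map (Ideal.Quotient.mk J))
    (fun h => ?_) (top_le_iff.mp (hg ▸ asymptoticSamuel_le_of_map_le _ le_rfl g))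
  have h1 := IsLocalRing.le_maximalIdeal hI
  have h2 := IsLocalRing.le_maximalIdeal hJ.ne_top
  have h3 := congrArg (Ideal.comap (Ideal.Quotient.mk J)) h
  rw [Ideal.comap_map_of_surjective _ Ideal.Quotient.mk_surjective, Ideal.comap_top,
    ← RingHom.ker_eq_comap_bot, Ideal.mk_ker] at h3
  exact (IsLocalRing.maximalIdeal.isMaximal R).ne_top (top_le_iff.mp (h3 ▸ sup_le h1 h2))

end Reductions

/-! ### Complete local rings -/

section Completion

variable {R : Type*} [CommRing R]

theorem exists_antitone_stabilizes {I : Ideal R} [IsArtinianRing (R ⧸ I)] (f : ℕ → Ideal R)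
    (hf : Antitone f) (hI : ∀ n, I ≤ f n) : ∃ n, ∀ m ≥ n, f m = f n := by
  obtain ⟨n, hn⟩ := IsArtinian.monotone_stabilizes (R := R ⧸ I) (M := R ⧸ I)
    ⟨fun n => OrderDual.toDual ((f n).map (Ideal.Quotient.mk I)),
      fun _ _ h => Ideal.map_mono (hf h)⟩
  have hc : ∀ n, ((f n).map (Ideal.Quotient.mk I)).comap (Ideal.Quotient.mk I) = f n := by
    intro n
    rw [Ideal.comap_map_of_surjective _ Ideal.Quotient.mk_surjective,
      ← RingHom.ker_eq_comap_bot, Ideal.mk_ker, sup_eq_left]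
    exact hI n
  refine ⟨n, fun m hm => ?_⟩
  have := hn m hm
  have h2 : (f n).map (Ideal.Quotient.mk I) = (f m).map (Ideal.Quotient.mk I) := this
  rw [← hc m, ← hc n, h2]

/-- Cauchy sequences for the `I`-adic topology converge. It suffices to consider sequences whose
`n`-th increment lies in `I ^ n`; no uniqueness of the limit is required. -/
def HasAdicLimits (I : Ideal R) : Prop :=
  ∀ f : ℕ → R, (∀ n, f (n + 1) - f n ∈ I ^ n) → ∃ L, ∀ n, L - f n ∈ I ^ n

theorem hasAdicLimits_of_isPrecomplete (I : Ideal R) [IsPrecomplete I R] : HasAdicLimits I := by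
  intro f hf
  have hmono : ∀ {m n : ℕ}, m ≤ n → f n - f m ∈ I ^ m := by
    intro m n h
    induction n, h using Nat.le_induction with
    | base => simp
    | succ n hmn ih =>
      have := add_mem (Ideal.pow_le_pow_right hmn (hf n)) ih
      simpa using this
  obtain ⟨L, hL⟩ := IsPrecomplete.prec' (I := I) f fun {m n} h => by
    rw [SModEq.comm, SModEq.sub_mem]
    simpa using hmono h
  refine ⟨L, fun n => ?_⟩
  have := (hL n).symm
  rw [SModEq.sub_mem] at this
  simpa using this

theorem HasAdicLimits.quotient {I : Ideal R} (h : HasAdicLimits I) (q : Ideal R) :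
    HasAdicLimits (I.map (Ideal.Quotient.mk q)) := by
  intro f hf
  have hex : ∀ n, ∃ d ∈ I ^ n, Ideal.Quotient.mk q d = f (n + 1) - f n := by
    intro n
    have := hf n
    rwa [← Ideal.map_pow, Ideal.mem_map_iff_of_surjective _ Ideal.Quotient.mk_surjective] at this
  choose d hd hdf using hex
  obtain ⟨a, ha⟩ := Ideal.Quotient.mk_surjective (f 0)
  have hs : ∀ n, Ideal.Quotient.mk q (a + ∑ i ∈ Finset.range n, d i) = f n := by
    intro n
    rw [map_add, map_sum, ha]
    simp only [hdf, Finset.sum_range_sub]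
    ring
  obtain ⟨L, hL⟩ := h (fun n => a + ∑ i ∈ Finset.range n, d i) fun n => by
    rw [Finset.sum_range_succ]
    simpa using hd n
  refine ⟨Ideal.Quotient.mk q L, fun n => ?_⟩
  rw [← hs n, ← map_sub, ← Ideal.map_pow]
  exact Ideal.mem_map_of_mem _ (hL n)

variable [IsNoetherianRing R] [IsLocalRing R]
open IsLocalRing

theorem isArtinianRing_quotient_pow_of_mem_minimalPrimes {I : Ideal R}
    (hI : maximalIdeal R ∈ I.minimalPrimes) (n : ℕ) : IsArtinianRing (R ⧸ I ^ n) := by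
  rcases Nat.eq_zero_or_pos n with rfl | hn
  · have : Subsingleton (R ⧸ I ^ 0) := by
      rw [pow_zero, Ideal.one_eq_top]; infer_instance
    infer_instance
  · refine IsLocalRing.quotient_artinian_of_mem_minimalPrimes_of_isLocalRing _ ⟨⟨hI.1.1, ?_⟩, ?_⟩
    · exact (Ideal.pow_le_self hn.ne').trans hI.1.2
    · intro J ⟨hJ, hJI⟩ hJm
      exact hI.2 ⟨hJ, hJ.le_of_pow_le hJI⟩ hJm

/-- Ideals of a Noetherian local ring are closed in the topology of the maximal ideal. -/
theorem mem_of_forall_mem_sup_pow {I : Ideal R} {x : R}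
    (h : ∀ n, x ∈ I ⊔ maximalIdeal R ^ n) : x ∈ I := by
  rw [← Ideal.Quotient.eq_zero_iff_mem]
  refine IsHausdorff.haus' (I := maximalIdeal R) _ fun n => ?_
  rw [SModEq.zero]
  obtain ⟨a, ha, b, hb, rfl⟩ := Submodule.mem_sup.mp (h n)
  rw [map_add, Ideal.Quotient.eq_zero_iff_mem.mpr ha, zero_add]
  have : Ideal.Quotient.mk I b = b • (1 : R ⧸ I) := by
    rw [Algebra.smul_def, mul_one]; rfl
  rw [this]
  exact Submodule.smul_mem_smul hb trivial

/-- **Chevalley's theorem**: in a complete Noetherian local ring, a decreasing sequence of ideals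
converges to its intersection. Modulo each power of the maximal ideal the sequence is stationary,
with stable value `E j`; an element of `E k` lifts successively to all `E (k + i)`, and the limit of
the lifts lies in the intersection. -/
theorem exists_le_iInf_sup_pow (hR : HasAdicLimits (maximalIdeal R)) (f : ℕ → Ideal R)
    (hf : Antitone f) (k : ℕ) : ∃ n, f n ≤ (⨅ n, f n) ⊔ maximalIdeal R ^ k := by
  by_contra! hcon
  have hstab : ∀ j, ∃ n, ∀ m ≥ n, f m ⊔ maximalIdeal R ^ j = f n ⊔ maximalIdeal R ^ j := by
    intro j
    have : IsArtinianRing (R ⧸ maximalIdeal R ^ j) :=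
      isArtinianRing_quotient_pow_of_mem_minimalPrimes
        ⟨⟨(maximalIdeal.isMaximal R).isPrime, le_rfl⟩, fun _ h _ => h.2⟩ j
    exact exists_antitone_stabilizes (I := maximalIdeal R ^ j) (fun n => f n ⊔ maximalIdeal R ^ j)
      (fun _ _ h => sup_le_sup_right (hf h) _) fun _ => le_sup_right
  choose N hN using hstab
  set E : ℕ → Ideal R := fun j => f (N j) ⊔ maximalIdeal R ^ j with hE
  have hEle : ∀ j n, E j ≤ f n ⊔ maximalIdeal R ^ j := by
    intro j n
    rcases le_total (N j) n with h | h
    · exact (hN j n h).ge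
    · exact sup_le_sup_right (hf h) _
  have hstep : ∀ j, ∀ x ∈ E j, ∃ y ∈ E (j + 1), y - x ∈ maximalIdeal R ^ j := by
    intro j x hx
    obtain ⟨a, ha, b, hb, rfl⟩ := Submodule.mem_sup.mp (hEle j (N (j + 1)) hx)
    exact ⟨a, Ideal.mem_sup_left ha, by simpa using hb⟩
  obtain ⟨x₀, hx₀, hx₀'⟩ : ∃ x ∈ E k, x ∉ (⨅ n, f n) ⊔ maximalIdeal R ^ k := by
    obtain ⟨x, hx, hx'⟩ := Set.not_subset.mp (hcon (N k))
    exact ⟨x, Ideal.mem_sup_left hx, hx'⟩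
  choose! s hs hs' using hstep
  let y : ℕ → R := fun i => Nat.rec x₀ (fun i x => s (k + i) x) i
  have hy : ∀ i, y i ∈ E (k + i) := by
    intro i
    induction i with
    | zero => exact hx₀
    | succ i ih => exact hs (k + i) _ ih
  have hy' : ∀ i, y (i + 1) - y i ∈ maximalIdeal R ^ (k + i) := fun i => hs' (k + i) _ (hy i)
  obtain ⟨L, hL⟩ := hR y fun i => Ideal.pow_le_pow_right (Nat.le_add_left i k) (hy' i)
  have hLmem : L ∈ ⨅ n, f n := by
    rw [Ideal.mem_iInf]
    intro n
    refine mem_of_forall_mem_sup_pow fun j => ?_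
    have h1 : L - y j ∈ f n ⊔ maximalIdeal R ^ j := Ideal.mem_sup_right (hL j)
    have hle : f n ⊔ maximalIdeal R ^ (k + j) ≤ f n ⊔ maximalIdeal R ^ j :=
      sup_le_sup_left (Ideal.pow_le_pow_right (Nat.le_add_left j k)) _
    have h2 : y j ∈ f n ⊔ maximalIdeal R ^ j := hle (hEle _ n (hy j))
    simpa using add_mem h1 h2
  have h0 : ∀ i, y i - x₀ ∈ maximalIdeal R ^ k := by
    intro i
    induction i with
    | zero => simp [y]
    | succ i ih =>
      have := add_mem (Ideal.pow_le_pow_right (Nat.le_add_right k i) (hy' i)) ih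
      simpa using this
  refine hx₀' ?_
  have h1 : L - x₀ ∈ maximalIdeal R ^ k := by simpa using add_mem (hL k) (h0 k)
  have := sub_mem (Ideal.mem_sup_left hLmem : L ∈ (⨅ n, f n) ⊔ maximalIdeal R ^ k)
    (Ideal.mem_sup_right h1)
  simpa using this

/-- Ideals primary to the maximal ideal have left gaps: for `c < b` the ideals `{ν̄_I > c}` contain a
fixed power of `I`, and modulo it they satisfy the descending chain condition. -/
theorem hasLeftGaps_of_maximalIdeal_mem_minimalPrimes {I : Ideal R}
    (hI : maximalIdeal R ∈ I.minimalPrimes) : HasLeftGaps I := by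
  intro b hb
  obtain ⟨N, hN⟩ := exists_nat_gt b
  have := isArtinianRing_quotient_pow_of_mem_minimalPrimes hI N
  -- a sequence which increases strictly to `b`
  let c : ℕ → ℝ≥0 := fun n => b * (n / (n + 1))
  have hcb : ∀ n, c n < b := by
    intro n
    refine mul_lt_of_lt_one_right hb ?_
    rw [div_lt_one (by positivity)]
    exact lt_add_one _
  have hcm : Monotone c := by
    intro m n h
    refine mul_le_mul_right ?_ b
    rw [div_le_div_iff₀ (by positivity) (by positivity)]
    have : (m : ℝ≥0) ≤ n := by exact_mod_cast h
    nlinarith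
  obtain ⟨n, hn⟩ := exists_antitone_stabilizes (I := I ^ N) (fun n => gtIdeal I (c n))
    (fun m n h g hg => lt_of_le_of_lt (ENNReal.coe_le_coe.mpr (hcm h)) hg) fun n g hg => by
      refine lt_of_lt_of_le ?_ (natCast_le_asymptoticSamuel I hg)
      have := ENNReal.coe_lt_coe.mpr ((hcb n).trans hN)
      simpa using this
  refine ⟨c n, hcb n, fun g hg => ?_⟩
  rw [le_asymptoticSamuel_iff_forall_lt]
  intro a ha
  obtain ⟨m, hm⟩ : ∃ m, a < c m := by
    obtain ⟨m, hm⟩ := exists_nat_gt (a / (b - a))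
    refine ⟨m, ?_⟩
    have hd : 0 < b - a := tsub_pos_of_lt ha
    rw [div_lt_iff₀ hd] at hm
    change a < b * (m / (m + 1))
    rw [← mul_div_assoc, lt_div_iff₀ (by positivity)]
    obtain ⟨d, rfl⟩ := exists_add_of_le ha.le
    rw [add_tsub_cancel_left] at hm
    linear_combination hm
  have h1 : g ∈ gtIdeal I (c (max n m)) := by
    rw [hn _ (le_max_left _ _)]; exact hg
  exact lt_of_lt_of_le (ENNReal.coe_lt_coe.mpr hm)
    ((ENNReal.coe_le_coe.mpr (hcm (le_max_right n m))).trans (le_of_lt h1))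

end Completion

/-! ### Completions of Noetherian local rings -/

section CompletionRing

variable {R : Type*} [CommRing R]

theorem pow_le_comap_pow {B : Type*} [CommRing B] {f : B →+* R} {J : Ideal B} {I : Ideal R}
    (h : J ≤ I.comap f) (n : ℕ) : J ^ n ≤ (I ^ n).comap f :=
  (Ideal.pow_right_mono h n).trans (Ideal.le_comap_pow f n)

/-- The map `AdicCompletion J B → R ⧸ I ^ n` induced by a ring homomorphism `f : B → R` with
`f J ⊆ I`. -/
noncomputable def adicCompletionEval {B : Type*} [CommRing B] (f : B →+* R) (J : Ideal B)
    (I : Ideal R) (h : J ≤ I.comap f) (n : ℕ) : AdicCompletion J B →+* R ⧸ I ^ n :=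
  (Ideal.quotientMap (I ^ n) f (pow_le_comap_pow h n)).comp (AdicCompletion.evalₐ J n).toRingHom

theorem adicCompletionEval_mk {B : Type*} [CommRing B] (f : B →+* R) (J : Ideal B)
    (I : Ideal R) (h : J ≤ I.comap f) (n : ℕ) (x : AdicCompletion.AdicCauchySequence J B) :
    adicCompletionEval f J I h n (AdicCompletion.mk J B x) =
      Ideal.Quotient.mk (I ^ n) (f (x.1 n)) := by
  simp only [adicCompletionEval, RingHom.comp_apply, AlgHom.toRingHom_eq_coe, RingHom.coe_coe,
    AdicCompletion.evalₐ_mk, Ideal.quotientMap_mk]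

theorem factorPow_comp_adicCompletionEval {B : Type*} [CommRing B] (f : B →+* R) (J : Ideal B)
    (I : Ideal R) (h : J ≤ I.comap f) {m n : ℕ} (hle : m ≤ n) :
    (Ideal.Quotient.factorPow I hle).comp (adicCompletionEval f J I h n) =
      adicCompletionEval f J I h m := by
  ext x
  induction x using AdicCompletion.induction_on with
  | _ x =>
    rw [RingHom.comp_apply, adicCompletionEval_mk, adicCompletionEval_mk]
    have h1 := (x.2 hle).symm
    rw [SModEq.sub_mem, smul_eq_mul, Ideal.mul_top] at h1
    change Ideal.Quotient.mk (I ^ m) (f (x.1 n)) = _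
    rw [Ideal.Quotient.eq, ← map_sub]
    exact pow_le_comap_pow h m h1

/-- The map of completions induced by a ring homomorphism `f` with `f J ⊆ I`. -/
noncomputable def adicCompletionMap {B : Type*} [CommRing B] (f : B →+* R) (J : Ideal B)
    (I : Ideal R) (h : J ≤ I.comap f) : AdicCompletion J B →+* AdicCompletion I R :=
  AdicCompletion.liftRingHom I (adicCompletionEval f J I h)
    (factorPow_comp_adicCompletionEval f J I h)

theorem adicCompletionMap_surjective {B : Type*} [CommRing B] (f : B →+* R)
    (hf : Function.Surjective f) (J : Ideal B) :
    Function.Surjective (adicCompletionMap f J (J.map f) Ideal.le_comap_map) := by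
  intro y
  induction y using AdicCompletion.induction_on with
  | _ y =>
    have hex : ∀ n, ∃ d ∈ J ^ n, f d = y.1 (n + 1) - y.1 n := by
      intro n
      have h1 := (y.2 n.le_succ).symm
      rw [SModEq.sub_mem, smul_eq_mul, Ideal.mul_top, ← Ideal.map_pow,
        Ideal.mem_map_iff_of_surjective _ hf] at h1
      exact h1
    choose d hd hdf using hex
    obtain ⟨a, ha⟩ := hf (y.1 0)
    have hs : ∀ n, f (a + ∑ i ∈ Finset.range n, d i) = y.1 n := by
      intro n
      rw [map_add, map_sum, ha]
      simp only [hdf, Finset.sum_range_sub]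
      ring
    refine ⟨AdicCompletion.mk J B (AdicCompletion.AdicCauchySequence.mk J B
      (fun n => a + ∑ i ∈ Finset.range n, d i) fun n => ?_), ?_⟩
    · rw [SModEq.comm, SModEq.sub_mem, smul_eq_mul, Ideal.mul_top, Finset.sum_range_succ]
      simpa using hd n
    · refine AdicCompletion.ext_evalₐ fun n => ?_
      refine (AdicCompletion.evalₐ_liftRingHom _ _
        (factorPow_comp_adicCompletionEval f J _ Ideal.le_comap_map) n _).trans ?_
      rw [adicCompletionEval_mk, AdicCompletion.evalₐ_mk]
      exact congrArg _ (hs n)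

/-- The completion of a Noetherian ring along `I` is Noetherian: it is a quotient of a power series
ring, which is the completion of a polynomial ring whose variables map to generators of `I`. -/
instance isNoetherianRing_adicCompletion [IsNoetherianRing R] (I : Ideal R) :
    IsNoetherianRing (AdicCompletion I R) := by
  obtain ⟨n, a, ha⟩ := Submodule.fg_iff_exists_fin_generating_family.mp
    (I.fg_of_isNoetherianRing : I.FG)
  let f : MvPolynomial (Fin n) R →+* R := (MvPolynomial.aeval a).toRingHom
  have hf : Function.Surjective f := fun r => ⟨MvPolynomial.C r, by simp [f]⟩
  have hJ : (MvPolynomial.idealOfVars (Fin n) R).map f = I := by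
    rw [MvPolynomial.idealOfVars, Ideal.map_span, ← Set.range_comp, ← ha]
    congr 2
    ext i
    simp [f]
  have := isNoetherianRing_of_surjective _ _
    (MvPowerSeries.toAdicCompletionAlgEquiv (Fin n) R).toRingEquiv.toRingHom
    (MvPowerSeries.toAdicCompletionAlgEquiv (Fin n) R).surjective
  rw [← hJ]
  exact isNoetherianRing_of_surjective _ _ _ (adicCompletionMap_surjective f hf _)

open IsLocalRing
variable [IsNoetherianRing R] [IsLocalRing R]

/-- Left gaps of a principal ideal descend from the completion, since the ideals `u ^ M R` are closed
and hence contracted from the completion. -/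
theorem hasLeftGaps_of_adicCompletion (u : R)
    (h : HasLeftGaps (Ideal.span
      {algebraMap R (AdicCompletion (maximalIdeal R) R) u})) : HasLeftGaps (Ideal.span {u}) := by
  refine hasLeftGaps_of_pow_mem_iff (algebraMap R (AdicCompletion (maximalIdeal R) R))
    (fun M g => ⟨fun hg => ?_, fun hg => ?_⟩) h
  · refine mem_of_forall_mem_sup_pow fun n => ?_
    rw [Ideal.span_singleton_pow, Ideal.mem_span_singleton] at hg
    obtain ⟨y, hy⟩ := hg
    have h1 := congrArg (AdicCompletion.evalₐ (maximalIdeal R) n) hy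
    rw [map_mul, map_pow, AlgHom.commutes, AlgHom.commutes] at h1
    obtain ⟨z, hz⟩ := Ideal.Quotient.mk_surjective (AdicCompletion.evalₐ (maximalIdeal R) n y)
    rw [← hz, Ideal.Quotient.algebraMap_eq, ← map_pow, ← map_mul, Ideal.Quotient.eq] at h1
    have h2 : u ^ M * z ∈ Ideal.span {u} ^ M := by
      rw [Ideal.span_singleton_pow]
      exact Ideal.mul_mem_right _ _ (Ideal.mem_span_singleton_self _)
    simpa using add_mem (Ideal.mem_sup_right h1 : _ ∈ Ideal.span {u} ^ M ⊔ maximalIdeal R ^ n)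
      (Ideal.mem_sup_left h2)
  · have := Ideal.mem_map_of_mem (algebraMap R (AdicCompletion (maximalIdeal R) R)) hg
    rwa [Ideal.map_pow, Ideal.map_span, Set.image_singleton] at this

theorem ringKrullDim_adicCompletion_le :
    ringKrullDim (AdicCompletion (maximalIdeal R) R) ≤ ringKrullDim R := by
  rw [← IsLocalRing.maximalIdeal_height_eq_ringKrullDim,
    ← IsLocalRing.maximalIdeal_height_eq_ringKrullDim]
  obtain ⟨s, hs, hs'⟩ := Ideal.exists_finset_card_eq_height_of_isNoetherianRing (maximalIdeal R)
  -- the maximal ideal of the completion is minimal over the same system of parameters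
  rw [← hs']
  classical
  set j := algebraMap R (AdicCompletion (maximalIdeal R) R) with hj
  have hmax : maximalIdeal (AdicCompletion (maximalIdeal R) R) = (maximalIdeal R).map j :=
    AdicCompletion.maximalIdeal_eq_map
  have hspan : Ideal.span ((s.image j : Finset _) : Set (AdicCompletion (maximalIdeal R) R)) =
      (Ideal.span (s : Set R)).map j := by
    rw [Finset.coe_image, Ideal.map_span]
  have hmin : maximalIdeal (AdicCompletion (maximalIdeal R) R) ∈
      (Ideal.span ((s.image j : Finset _) :
        Set (AdicCompletion (maximalIdeal R) R))).minimalPrimes := by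
    rw [hspan]
    refine ⟨⟨(maximalIdeal.isMaximal _).isPrime, ?_⟩, fun q hq _ => ?_⟩
    · rw [hmax]
      exact Ideal.map_mono hs.1.2
    · have hq1 : q.IsPrime := hq.1
      rw [hmax, Ideal.map_le_iff_le_comap]
      exact hs.2 ⟨hq1.comap j, Ideal.map_le_iff_le_comap.mp hq.2⟩
        (le_maximalIdeal (hq1.comap j).ne_top)
  have := (Ideal.height_le_card_of_mem_minimalPrimes_span_finset hmin).trans
    (Nat.cast_le.mpr Finset.card_image_le)
  exact WithBot.coe_le_coe.mpr this

end CompletionRing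

/-! ### The ideal transform of a complete local domain -/

section GlobalTransform

open IsLocalRing
variable {T : Type*} [CommRing T] [IsLocalRing T]

/-- The saturation `(I : 𝔪^∞)` of an ideal of a local ring. -/
def saturation (I : Ideal T) : Ideal T where
  carrier := {x | ∀ s ∈ maximalIdeal T, ∃ k : ℕ, s ^ k * x ∈ I}
  zero_mem' s _ := ⟨0, by simp⟩
  add_mem' {x y} hx hy s hs := by
    obtain ⟨k, hk⟩ := hx s hs
    obtain ⟨l, hl⟩ := hy s hs
    refine ⟨k + l, ?_⟩
    have := add_mem (I.mul_mem_left (s ^ l) hk) (I.mul_mem_left (s ^ k) hl)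
    convert this using 1
    ring
  smul_mem' a x hx s hs := by
    obtain ⟨k, hk⟩ := hx s hs
    refine ⟨k, ?_⟩
    have := I.mul_mem_left a hk
    convert this using 1
    simp only [smul_eq_mul]; ring

theorem saturation_mono {I J : Ideal T} (h : I ≤ J) : saturation I ≤ saturation J :=
  fun _ hx s hs => (hx s hs).imp fun _ hk => h hk

variable [IsNoetherianRing T]

theorem exists_maximalIdeal_pow_smul_saturation_le (I : Ideal T) :
    ∃ k, maximalIdeal T ^ k • saturation I ≤ I := by
  obtain ⟨S, hS⟩ := (saturation I).fg_of_isNoetherianRing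
  have hrad : maximalIdeal T ≤ (I.colon (S : Set T)).radical := by
    intro s hs
    have hS' : ∀ x ∈ S, ∃ k : ℕ, s ^ k * x ∈ I := fun x hx =>
      (hS ▸ Submodule.subset_span hx : x ∈ saturation I) s hs
    choose! k hk using hS'
    refine ⟨S.sup k, ?_⟩
    rw [Submodule.mem_colon]
    intro x hx
    obtain ⟨l, hl⟩ := Nat.exists_eq_add_of_le (Finset.le_sup (f := k) hx)
    rw [hl, smul_eq_mul, pow_add, mul_right_comm]
    exact I.mul_mem_right _ (hk x hx)
  obtain ⟨k, hk⟩ := Ideal.exists_pow_le_of_le_radical_of_fg hrad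
    (maximalIdeal T).fg_of_isNoetherianRing
  refine ⟨k, ?_⟩
  rw [← hS, Submodule.smul_le]
  intro r hr x hx
  have : Submodule.span T (S : Set T) ≤ Submodule.comap (LinearMap.mulLeft T r) I := by
    rw [Submodule.span_le]
    intro y hy
    exact Submodule.mem_colon.mp (hk hr) y hy
  exact this hx

variable [IsDomain T] {u : T}

/-- The saturations of the ideals `u ^ n T` have zero intersection: localization at a prime
`Q ≠ 𝔪` containing `u` inverts an element of `𝔪`, and Krull's intersection theorem applies. -/
theorem iInf_saturation_pow_eq_bot {Q : Ideal T} [Q.IsPrime] (huQ : u ∈ Q)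
    (hQ : Q ≠ maximalIdeal T) : ⨅ n : ℕ, saturation (Ideal.span {u ^ n}) = ⊥ := by
  rw [eq_bot_iff]
  intro x hx
  rw [Ideal.mem_iInf] at hx
  obtain ⟨s, hs, hsQ⟩ : ∃ s ∈ maximalIdeal T, s ∉ Q := by
    by_contra! h
    exact hQ (le_antisymm (le_maximalIdeal (Ideal.IsPrime.ne_top inferInstance)) h)
  set L := Localization.AtPrime Q
  have hx0 : algebraMap T L x ∈ ⨅ n : ℕ, maximalIdeal L ^ n := by
    rw [Ideal.mem_iInf]
    intro n
    obtain ⟨k, hk⟩ := hx n s hs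
    rw [Ideal.mem_span_singleton] at hk
    have h1 : IsUnit (algebraMap T L (s ^ k)) :=
      IsLocalization.map_units L (⟨s ^ k, Q.primeCompl.pow_mem hsQ k⟩ : Q.primeCompl)
    have h2 : algebraMap T L (s ^ k) * algebraMap T L x ∈ maximalIdeal L ^ n := by
      obtain ⟨y, hy⟩ := hk
      rw [← map_mul, hy, map_mul, map_pow]
      refine Ideal.mul_mem_right _ _ (Ideal.pow_mem_pow ?_ n)
      rw [IsLocalization.AtPrime.to_map_mem_maximal_iff L Q]
      exact huQ
    exact (Ideal.unit_mul_mem_iff_mem _ h1).mp h2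
  rw [Ideal.iInf_pow_eq_bot_of_isLocalRing _ (maximalIdeal.isMaximal L).ne_top] at hx0
  exact IsLocalization.injective L Q.primeCompl_le_nonZeroDivisors
    (by rw [map_zero]; exact hx0)

/-- By Chevalley's theorem the saturation of `u ^ n T` lies in a high power of `𝔪` for large `n`; the
Artin–Rees lemma and the fact that a power of `𝔪` maps the saturation of `u T` into `u T` put it
inside `u T`. -/
theorem exists_saturation_pow_le {Q : Ideal T} [Q.IsPrime] (huQ : u ∈ Q)
    (hQ : Q ≠ maximalIdeal T) (hT : HasAdicLimits (maximalIdeal T)) :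
    ∃ n₀ : ℕ, saturation (Ideal.span {u ^ n₀}) ≤ Ideal.span {u} := by
  have hanti : Antitone fun n : ℕ => saturation (Ideal.span {u ^ n}) := fun m n h =>
    saturation_mono (by
      rw [Ideal.span_singleton_le_span_singleton]
      exact pow_dvd_pow u h)
  obtain ⟨k, hk⟩ := exists_maximalIdeal_pow_smul_saturation_le (Ideal.span {u})
  obtain ⟨c, hc⟩ := Ideal.exists_pow_inf_eq_pow_smul (maximalIdeal T) (saturation (Ideal.span {u}))
  obtain ⟨n, hn⟩ := exists_le_iInf_sup_pow hT _ hanti (c + k)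
  rw [iInf_saturation_pow_eq_bot huQ hQ, bot_sup_eq] at hn
  refine ⟨max n 1, fun x hx => hk ?_⟩
  have h1 : x ∈ saturation (Ideal.span {u}) := by
    have := hanti (le_max_right n 1) hx
    simpa using this
  have h2 : x ∈ maximalIdeal T ^ (c + k) • ⊤ ⊓ saturation (Ideal.span {u}) :=
    ⟨by simpa using hn (hanti (le_max_left n 1) hx), h1⟩
  rw [hc _ (Nat.le_add_right c k), Nat.add_sub_cancel_left] at h2
  exact Submodule.smul_mono le_rfl inf_le_right h2

variable (T) in
/-- The ideal transform of a local domain at its maximal ideal: the fractions `z` such that every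
element of `𝔪` has a power multiplying `z` into the ring. -/
def idealTransform : Subalgebra T (FractionRing T) where
  carrier := {z | ∀ s ∈ maximalIdeal T, ∃ (k : ℕ) (x : T),
    algebraMap T _ (s ^ k) * z = algebraMap T _ x}
  mul_mem' {z w} hz hw s hs := by
    obtain ⟨k, x, hx⟩ := hz s hs
    obtain ⟨l, y, hy⟩ := hw s hs
    refine ⟨k + l, x * y, ?_⟩
    rw [pow_add, map_mul, map_mul, ← hx, ← hy]
    ring
  add_mem' {z w} hz hw s hs := by
    obtain ⟨k, x, hx⟩ := hz s hs
    obtain ⟨l, y, hy⟩ := hw s hs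
    refine ⟨k + l, s ^ l * x + s ^ k * y, ?_⟩
    rw [pow_add, map_add, map_mul, map_mul, map_mul, ← hx, ← hy]
    ring
  algebraMap_mem' r s _ := ⟨0, r, by simp⟩

/-- The elements of the ideal transform have a common denominator, a power of `u`. -/
theorem exists_mul_eq_of_mem_idealTransform {Q : Ideal T} [Q.IsPrime] (hu : u ≠ 0) (huQ : u ∈ Q)
    (hQ : Q ≠ maximalIdeal T) (hT : HasAdicLimits (maximalIdeal T)) :
    ∃ n₀ : ℕ, ∀ z ∈ idealTransform T, ∃ x, algebraMap T (FractionRing T) (u ^ n₀) * z =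
      algebraMap T _ x := by
  obtain ⟨n₀, hn₀⟩ := exists_saturation_pow_le huQ hQ hT
  have hum : u ∈ maximalIdeal T := le_maximalIdeal (Ideal.IsPrime.ne_top inferInstance) huQ
  have hu' : algebraMap T (FractionRing T) u ≠ 0 := by
    rwa [Ne, map_eq_zero_iff _ (IsFractionRing.injective T (FractionRing T))]
  refine ⟨n₀, fun z hz => ?_⟩
  -- descend from a power of `u` which multiplies `z` into `T`
  have key : ∀ j : ℕ, (∃ x, algebraMap T (FractionRing T) (u ^ (n₀ + j)) * z =
      algebraMap T _ x) → ∃ x, algebraMap T (FractionRing T) (u ^ n₀) * z =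
      algebraMap T _ x := by
    intro j
    induction j with
    | zero => exact id
    | succ j ih =>
      rintro ⟨x, hx⟩
      have hxs : x ∈ saturation (Ideal.span {u ^ n₀}) := by
        intro s hs
        obtain ⟨k, y, hy⟩ := hz s hs
        refine ⟨k, Ideal.mem_span_singleton.mpr ⟨u ^ (j + 1) * y, ?_⟩⟩
        apply IsFractionRing.injective T (FractionRing T)
        rw [map_mul, ← hx, map_mul _ (u ^ n₀), map_mul _ (u ^ (j + 1)), ← hy, pow_add u, map_mul]
        ring
      obtain ⟨x', rfl⟩ := Ideal.mem_span_singleton.mp (hn₀ hxs)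
      refine ih ⟨x', mul_left_cancel₀ hu' ?_⟩
      rw [← map_mul, ← hx, ← add_assoc, pow_succ', map_mul, mul_assoc]
  obtain ⟨k, x, hx⟩ := hz u hum
  exact key k ⟨u ^ n₀ * x, by rw [pow_add, map_mul, map_mul, mul_assoc, hx]⟩

theorem finite_idealTransform {Q : Ideal T} [Q.IsPrime] (hu : u ≠ 0) (huQ : u ∈ Q)
    (hQ : Q ≠ maximalIdeal T) (hT : HasAdicLimits (maximalIdeal T)) :
    Module.Finite T (idealTransform T) := by
  obtain ⟨n₀, hn₀⟩ := exists_mul_eq_of_mem_idealTransform hu huQ hQ hT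
  have hu' : algebraMap T (FractionRing T) (u ^ n₀) ≠ 0 := by
    rw [Ne, map_eq_zero_iff _ (IsFractionRing.injective T (FractionRing T))]
    exact pow_ne_zero _ hu
  have hle : Subalgebra.toSubmodule (idealTransform T) ≤
      Submodule.span T {(algebraMap T (FractionRing T) (u ^ n₀))⁻¹} := by
    intro z hz
    obtain ⟨x, hx⟩ := hn₀ z hz
    rw [Submodule.mem_span_singleton]
    refine ⟨x, ?_⟩
    rw [Algebra.smul_def, ← hx]
    field_simp
  have : IsNoetherian T (Submodule.span T {(algebraMap T (FractionRing T) (u ^ n₀))⁻¹}) :=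
    isNoetherian_span_of_finite T (Set.finite_singleton _)
  have : IsNoetherian T (Subalgebra.toSubmodule (idealTransform T)) := isNoetherian_of_le hle
  exact (inferInstance : Module.Finite T (Subalgebra.toSubmodule (idealTransform T)))

omit [IsNoetherianRing T] in
theorem div_mem_idealTransform (hu : u ≠ 0) {y : FractionRing T}
    (hy : ∀ s ∈ maximalIdeal T, ∃ w ∈ idealTransform T,
      algebraMap T (FractionRing T) s * y = algebraMap T (FractionRing T) u * w) :
    y / algebraMap T _ u ∈ idealTransform T := by
  have hu' : algebraMap T (FractionRing T) u ≠ 0 := by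
    rwa [Ne, map_eq_zero_iff _ (IsFractionRing.injective T (FractionRing T))]
  intro s hs
  obtain ⟨w, hwD, hw⟩ := hy s hs
  obtain ⟨k, x, hx⟩ := hwD s hs
  refine ⟨k + 1, x, ?_⟩
  rw [← hx, pow_succ, map_mul, mul_assoc, ← mul_div_assoc, hw, mul_div_cancel_left₀ _ hu']

/-- A finite extension domain `D` of a complete local domain `T` in which `𝔪 y ⊆ u D` implies
`y ∈ u D`, provided that some prime `Q ≠ 𝔪` contains `u`: the ideal transform of `T`. -/
theorem exists_finite_extension_depth.{v} {T : Type v} [CommRing T] [IsLocalRing T]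
    [IsNoetherianRing T] [IsDomain T] {u : T} {Q : Ideal T} [Q.IsPrime] (hu : u ≠ 0) (huQ : u ∈ Q)
    (hQ : Q ≠ maximalIdeal T) (hT : HasAdicLimits (maximalIdeal T)) :
    ∃ (D : Type v) (_ : CommRing D) (_ : IsDomain D) (_ : Algebra T D),
      Module.Finite T D ∧ Function.Injective (algebraMap T D) ∧
      ∀ y : D, (∀ s ∈ maximalIdeal T, algebraMap T D s * y ∈ Ideal.span {algebraMap T D u}) →
        y ∈ Ideal.span {algebraMap T D u} := by
  refine ⟨idealTransform T, inferInstance, inferInstance, inferInstance,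
    finite_idealTransform hu huQ hQ hT, fun a b hab => ?_, fun y hy => ?_⟩
  · exact IsFractionRing.injective T (FractionRing T) (congrArg Subtype.val hab)
  · have hu' : algebraMap T (FractionRing T) u ≠ 0 := by
      rwa [Ne, map_eq_zero_iff _ (IsFractionRing.injective T (FractionRing T))]
    have hz := div_mem_idealTransform hu (y := y.1) fun s hs => by
      obtain ⟨w, hw⟩ := Ideal.mem_span_singleton.mp (hy s hs)
      exact ⟨w.1, w.2, congrArg Subtype.val hw⟩
    refine Ideal.mem_span_singleton.mpr ⟨⟨_, hz⟩, Subtype.ext ?_⟩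
    change (y : FractionRing T) = algebraMap T (FractionRing T) u * (y / algebraMap T _ u)
    rw [mul_div_cancel₀ _ hu']

omit [IsNoetherianRing T] [IsDomain T] in
/-- Under the conclusion of `exists_finite_extension_depth`, no prime associated to `u D` lies
over the maximal ideal. -/
theorem comap_ne_maximalIdeal_of_associatedPrimes {D : Type*} [CommRing D] [IsNoetherianRing D]
    [Algebra T D] (hD : ∀ y : D, (∀ s ∈ maximalIdeal T,
      algebraMap T D s * y ∈ Ideal.span {algebraMap T D u}) → y ∈ Ideal.span {algebraMap T D u})
    {P : Ideal D} (hP : P ∈ associatedPrimes D (D ⧸ Ideal.span {algebraMap T D u})) :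
    P.comap (algebraMap T D) ≠ maximalIdeal T := by
  intro hPm
  rw [AssociatedPrimes.mem_iff, isAssociatedPrime_iff] at hP
  obtain ⟨hPp, y, hy⟩ := hP
  obtain ⟨y, rfl⟩ := Ideal.Quotient.mk_surjective y
  have hmem : ∀ d : D, d ∈ P ↔ d * y ∈ Ideal.span {algebraMap T D u} := by
    intro d
    rw [hy, Submodule.mem_colon_singleton, Submodule.mem_bot, Algebra.smul_def,
      Ideal.Quotient.algebraMap_eq, ← map_mul, Ideal.Quotient.eq_zero_iff_mem]
  refine hPp.ne_top ((Ideal.eq_top_iff_one P).mpr ?_)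
  rw [hmem, one_mul]
  refine hD y fun s hs => ?_
  rwa [← hPm, Ideal.mem_comap, hmem] at hs

end GlobalTransform

/-! ### Left gaps in Noetherian rings -/

section Induction

universe v
open IsLocalRing

theorem hasLeftGaps_bot {R : Type*} [CommRing R] : HasLeftGaps (⊥ : Ideal R) := by
  intro b hb
  refine ⟨0, hb, fun g hg => ?_⟩
  obtain ⟨k, M, hk, hM, hc⟩ := (coe_lt_asymptoticSamuel_iff _).mp hg
  have hM0 : M ≠ 0 := by
    rintro rfl
    simp at hc
  rw [← Ideal.zero_eq_bot, zero_pow hM0, Ideal.zero_eq_bot, Ideal.mem_bot] at hM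
  refine le_asymptoticSamuel_iff_forall_lt.mpr fun c _ => ?_
  obtain ⟨N, hN⟩ := exists_nat_gt (c * k : ℝ)
  exact (coe_lt_asymptoticSamuel_iff _).mpr ⟨k, N, hk, hM ▸ zero_mem _, hN⟩

theorem hasLeftGaps_top {R : Type*} [CommRing R] : HasLeftGaps (⊤ : Ideal R) := by
  intro b hb
  refine ⟨0, hb, fun g _ => le_asymptoticSamuel_iff_forall_lt.mpr fun c _ => ?_⟩
  obtain ⟨N, hN⟩ := exists_nat_gt (c * (1 : ℕ) : ℝ)
  exact (coe_lt_asymptoticSamuel_iff _).mpr ⟨1, N, one_pos, by simp [Ideal.top_pow], hN⟩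

/-- Heights do not decrease under contraction along an integral extension, by incomparability. -/
theorem height_le_height_comap_of_isIntegral {R S : Type*} [CommRing R] [CommRing S]
    [Algebra R S] [Algebra.IsIntegral R S] (P : Ideal S) [P.IsPrime] :
    P.height ≤ (P.comap (algebraMap R S)).height := by
  have hP : (P.comap (algebraMap R S)).IsPrime := inferInstance
  have h := Order.height_le_height_apply_of_strictMono
    (PrimeSpectrum.comap (algebraMap R S)) (fun I J h => Ideal.IsIntegral.comap_lt_comap h)
    ⟨P, ‹_›⟩
  rw [← PrimeSpectrum.height_eq_orderHeight, ← PrimeSpectrum.height_eq_orderHeight] at h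
  exact h

/-- If the principal ideals of complete local domains of dimension less than `n` have left gaps,
then so have those of all Noetherian local rings of dimension less than `n`. -/
theorem hasLeftGaps_span_of_complete_domains {n : ℕ}
    (h : ∀ (T : Type v) [CommRing T] [IsLocalRing T] [IsNoetherianRing T] [IsDomain T],
      HasAdicLimits (maximalIdeal T) → ringKrullDim T < n → ∀ u : T, HasLeftGaps (Ideal.span {u}))
    (L : Type v) [CommRing L] [IsLocalRing L] [IsNoetherianRing L] (hL : ringKrullDim L < n)
    (u : L) : HasLeftGaps (Ideal.span {u}) := by
  refine hasLeftGaps_of_adicCompletion u (hasLeftGaps_of_minimalPrimes fun q hq => ?_)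
  have hqp : q.IsPrime := hq.1.1
  set C := AdicCompletion (maximalIdeal L) L
  have hsurj : Function.Surjective (Ideal.Quotient.mk q) := Ideal.Quotient.mk_surjective
  have : IsLocalRing (C ⧸ q) := IsLocalRing.of_surjective' _ hsurj
  rw [Ideal.map_span, Set.image_singleton]
  refine h (C ⧸ q) ?_ ?_ _
  · have : IsPrecomplete (maximalIdeal C) C := inferInstance
    have h1 := (hasAdicLimits_of_isPrecomplete (maximalIdeal C)).quotient q
    have h2 : (maximalIdeal C).map (Ideal.Quotient.mk q) = maximalIdeal (C ⧸ q) :=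
      IsLocalRing.map_maximalIdeal_of_surjective _ hsurj
    rwa [h2] at h1
  · exact ((ringKrullDim_quotient_le q).trans ringKrullDim_adicCompletion_le).trans_lt hL

/-- The case of principal ideals of complete local domains, by induction on the dimension. If
`u T` is not primary to the maximal ideal, there is a finite extension `D` of `T` such that all
primes associated to `u D` have height less than `dim T`. -/
theorem hasLeftGaps_span_of_complete_domain (n : ℕ) :
    ∀ (T : Type v) [CommRing T] [IsLocalRing T] [IsNoetherianRing T] [IsDomain T],
      HasAdicLimits (maximalIdeal T) → ringKrullDim T < n →
        ∀ u : T, HasLeftGaps (Ideal.span {u}) := by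
  induction n with
  | zero =>
    intro T _ _ _ _ _ h
    exact absurd h (not_lt.mpr ringKrullDim_nonneg_of_nontrivial)
  | succ n ih =>
    intro T _ _ _ _ hT hdim u
    rcases eq_or_ne u 0 with rfl | hu
    · rw [Ideal.span_singleton_eq_bot.mpr rfl]
      exact hasLeftGaps_bot
    by_cases hum : u ∈ maximalIdeal T
    swap
    · rw [Ideal.span_singleton_eq_top.mpr (by simpa using hum)]
      exact hasLeftGaps_top
    by_cases hmin : maximalIdeal T ∈ (Ideal.span {u}).minimalPrimes
    · exact hasLeftGaps_of_maximalIdeal_mem_minimalPrimes hmin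
    obtain ⟨Q, hQp, huQ, hQ⟩ : ∃ Q : Ideal T, Q.IsPrime ∧ u ∈ Q ∧ Q ≠ maximalIdeal T := by
      by_contra! hcon
      refine hmin ⟨⟨(maximalIdeal.isMaximal T).isPrime,
        (Ideal.span_singleton_le_iff_mem _).mpr hum⟩, fun Q hQ _ => ?_⟩
      rw [hcon Q hQ.1 ((Ideal.span_singleton_le_iff_mem _).mp hQ.2)]
    obtain ⟨D, _, _, _, _, hinj, hD⟩ := exists_finite_extension_depth hu huQ hQ hT
    have : IsNoetherianRing D := IsNoetherianRing.of_finite T D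
    refine hasLeftGaps_of_isIntegral_algebra hinj ?_
    rw [Ideal.map_span, Set.image_singleton]
    refine hasLeftGaps_of_associatedPrimes (mem_nonZeroDivisors_of_ne_zero
      ((map_ne_zero_iff _ hinj).mpr hu)) fun P => ?_
    rw [Ideal.map_span, Set.image_singleton]
    have hPp : P.1.IsPrime := P.2.isPrime
    refine hasLeftGaps_span_of_complete_domains ih _ ?_ _
    have hlt : P.1.comap (algebraMap T D) < maximalIdeal T :=
      lt_of_le_of_ne (le_maximalIdeal (hPp.comap _).ne_top)
        (comap_ne_maximalIdeal_of_associatedPrimes hD P.2)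
    have h1 := Ideal.height_strict_mono_of_isPrime_of_isPrime hlt
    have h2 := (height_le_height_comap_of_isIntegral (R := T) P.1).trans_lt h1
    rw [← maximalIdeal_height_eq_ringKrullDim] at hdim
    rw [IsLocalization.AtPrime.ringKrullDim_eq_height P.1]
    have h3 : (maximalIdeal T).height < ((n + 1 : ℕ) : ℕ∞) := WithBot.coe_lt_coe.mp hdim
    have h4 : (maximalIdeal T).height ≤ (n : ℕ∞) := by
      push_cast at h3
      exact Order.le_of_lt_add_one h3
    exact WithBot.coe_lt_coe.mpr (h2.trans_le h4)

/-- The values of `ν̄_I` on a Noetherian ring do not accumulate at any real number from the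
left. -/
theorem hasLeftGaps {R : Type v} [CommRing R] [IsNoetherianRing R] (I : Ideal R) :
    HasLeftGaps I := by
  refine hasLeftGaps_of_extendedRees I (hasLeftGaps_of_associatedPrimes
    (extendedReesParam_mem_nonZeroDivisors I) fun Q => ?_)
  rw [Ideal.map_span, Set.image_singleton]
  have hQp : Q.1.IsPrime := Q.2.isPrime
  obtain ⟨n, hn⟩ : ∃ n : ℕ, ringKrullDim (Localization.AtPrime Q.1) < n := by
    have h : (maximalIdeal (Localization.AtPrime Q.1)).height < ⊤ :=
      Ideal.height_lt_top_of_isPrime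
    obtain ⟨n, hn⟩ := ENat.ne_top_iff_exists.mp h.ne
    refine ⟨n + 1, ?_⟩
    rw [← maximalIdeal_height_eq_ringKrullDim, ← hn]
    exact WithBot.coe_lt_coe.mpr (by exact_mod_cast n.lt_succ_self)
  exact hasLeftGaps_span_of_complete_domains (hasLeftGaps_span_of_complete_domain n) _ hn _

end Induction

/-! ### Descent of integral dependence along smooth algebras -/

section EtaleDescent

open Polynomial TensorProduct

/-- Descent of integrality along a smooth extension `A → B`: if the `k`-th power of `β ⊗ c` comes
from `B ⊗ R₀`, then `β ⊗ c` is a `B`-combination of elements integral over `R₀`. -/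
theorem mem_span_isIntegral_of_smooth {A B R₀ C E : Type*} [CommRing A] [CommRing B] [CommRing R₀]
    [CommRing C] [CommRing E] [Algebra A B] [Algebra.Smooth A B] [Algebra A R₀] [Algebra R₀ C]
    [Algebra A C] [IsScalarTower A R₀ C] [Algebra A E] [Algebra B E] [Algebra R₀ E] [Algebra C E]
    [IsScalarTower A B E] [IsScalarTower A R₀ E] [IsScalarTower R₀ C E]
    {L : Ideal A} {k : ℕ} (hk : 0 < k) {β : B} {c : C} (hβ : β ^ k ∈ L.map (algebraMap A B))
    (hL : ∀ a ∈ L, ∃ r : R₀, algebraMap R₀ C r = algebraMap A C a * c ^ k) :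
    algebraMap B E β * algebraMap C E c ∈
      Submodule.span B (algebraMap C E '' {c' | IsIntegral R₀ c'}) := by
  let S := R₀ ⊗[A] B
  let x : S ⊗[R₀] C := (1 ⊗ₜ β) ⊗ₜ c
  have hrange : ∀ b ∈ L.map (algebraMap A B), ((1 ⊗ₜ b : S) ⊗ₜ (c ^ k) : S ⊗[R₀] C) ∈
      (algebraMap S (S ⊗[R₀] C)).range := by
    intro b hb
    induction hb using Submodule.span_induction with
    | zero => simp
    | add b b' _ _ h h' =>
      rw [tmul_add, add_tmul]
      exact add_mem h h'
    | smul b b' _ h =>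
      have : ((1 ⊗ₜ (b • b') : S) ⊗ₜ (c ^ k) : S ⊗[R₀] C) =
          algebraMap S (S ⊗[R₀] C) (1 ⊗ₜ b) * ((1 ⊗ₜ b' : S) ⊗ₜ (c ^ k)) := by
        rw [Algebra.TensorProduct.algebraMap_apply, Algebra.TensorProduct.tmul_mul_tmul, one_mul]
        simp [S]
      rw [this]
      exact mul_mem ⟨_, rfl⟩ h
    | mem b hb =>
      obtain ⟨a, ha, rfl⟩ := hb
      obtain ⟨r, hr⟩ := hL a ha
      refine ⟨algebraMap R₀ S r, ?_⟩
      have h1 : (1 ⊗ₜ algebraMap A B a : S) = algebraMap R₀ S (algebraMap A R₀ a) := by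
        rw [Algebra.TensorProduct.algebraMap_apply, Algebra.algebraMap_self_apply,
          Algebra.algebraMap_eq_smul_one, Algebra.algebraMap_eq_smul_one, smul_tmul]
      rw [h1, ← IsScalarTower.algebraMap_apply, Algebra.algebraMap_eq_smul_one (A := S),
        smul_tmul, Algebra.smul_def, ← IsScalarTower.algebraMap_apply, ← hr,
        Algebra.algebraMap_eq_smul_one (A := C), ← smul_tmul,
        Algebra.algebraMap_eq_smul_one, Algebra.TensorProduct.one_def, smul_tmul']
  have hx : IsIntegral S x := by
    refine IsIntegral.of_pow hk ?_
    have : x ^ k = (1 ⊗ₜ (β ^ k) : S) ⊗ₜ (c ^ k) := by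
      simp only [x, S, Algebra.TensorProduct.tmul_pow, one_pow]
    obtain ⟨s, hs⟩ := hrange _ hβ
    rw [this, ← hs]
    exact isIntegral_algebraMap
  obtain ⟨y, hy⟩ := (TensorProduct.toIntegralClosure_bijective_of_smooth (R := R₀) (S := S)
    (B := C)).2 ⟨x, hx⟩
  let ψ : S →ₐ[R₀] E := Algebra.TensorProduct.lift (Algebra.ofId R₀ E)
    (IsScalarTower.toAlgHom A B E) (fun _ _ => Commute.all _ _)
  let Ψ : S ⊗[R₀] C →ₐ[R₀] E := Algebra.TensorProduct.lift ψ (IsScalarTower.toAlgHom R₀ C E)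
    (fun _ _ => Commute.all _ _)
  have hψ : ∀ (r : R₀) (b : B), ψ (r ⊗ₜ b) = algebraMap R₀ E r * algebraMap B E b :=
    fun r b => Algebra.TensorProduct.lift_tmul _ _ _ r b
  have hΨ : ∀ (r : R₀) (b : B) (c : C), Ψ ((r ⊗ₜ b) ⊗ₜ c) =
      b • algebraMap C E (r • c) := by
    intro r b c
    simp only [Ψ, Algebra.TensorProduct.lift_tmul, hψ, IsScalarTower.toAlgHom_apply,
      Algebra.smul_def, map_mul]
    rw [← IsScalarTower.algebraMap_apply]
    ring
  have hΨx : Ψ x = algebraMap B E β * algebraMap C E c := by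
    simp only [x, hΨ, one_smul]
    rw [Algebra.smul_def]
  rw [← hΨx, show x = (TensorProduct.toIntegralClosure R₀ S C y : S ⊗[R₀] C) by rw [hy]]
  clear hy
  induction y with
  | zero => simp
  | add y z hy hz =>
    rw [map_add, AddMemClass.coe_add, map_add]
    exact add_mem hy hz
  | tmul s z =>
    have : (TensorProduct.toIntegralClosure R₀ S C (s ⊗ₜ z) : S ⊗[R₀] C) = s ⊗ₜ z.1 := rfl
    rw [this]
    clear this
    induction s using TensorProduct.induction_on with
    | zero => simp
    | add s s' hs hs' =>
      rw [add_tmul, map_add]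
      exact add_mem hs hs'
    | tmul r b =>
      rw [hΨ]
      exact Submodule.smul_mem _ _ (Submodule.subset_span ⟨_, z.2.smul r, rfl⟩)

attribute [local instance] Polynomial.algebra in
/-- If the `k`-th power of `β ∈ B` lies in `I ^ M B` with `B` smooth over `A`, then `β` is a
`B`-combination of elements of `A` satisfying equations of integral dependence of weight `M / k`
over `I`. -/
theorem mem_map_of_pow_mem_map_of_smooth {A B : Type*} [CommRing A] [CommRing B] [Algebra A B]
    [Algebra.Smooth A B] {I J : Ideal A} {M k : ℕ} (hk : 0 < k) {β : B}
    (hβ : β ^ k ∈ (I ^ M).map (algebraMap A B))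
    (hJ : ∀ g, IsIntegral (weightedRees I M k) (monomial 1 g : A[X]) → g ∈ J) :
    β ∈ J.map (algebraMap A B) := by
  have hX := mem_span_isIntegral_of_smooth (R₀ := weightedRees I M k) (C := A[X]) (E := B[X])
    hk (c := X) hβ fun a ha => ⟨⟨_, monomial_mem_weightedRees (k := k) ha⟩, by
      rw [Polynomial.algebraMap_apply, Algebra.algebraMap_self_apply, C_mul_X_pow_eq_monomial]
      rfl⟩
  have hsub : ∀ f ∈ Submodule.span B (algebraMap A[X] B[X] ''
      {c' | IsIntegral (weightedRees I M k) c'}), f.coeff 1 ∈ J.map (algebraMap A B) := by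
    intro f hf
    induction hf using Submodule.span_induction with
    | zero => simp
    | add f g _ _ hf hg => rw [coeff_add]; exact add_mem hf hg
    | smul b f _ hf => rw [coeff_smul]; exact Ideal.mul_mem_left _ _ hf
    | mem f hf =>
      obtain ⟨f, hf, rfl⟩ := hf
      rw [Polynomial.algebraMap_def, coe_mapRingHom, coeff_map]
      exact Ideal.mem_map_of_mem _ (hJ _ (isIntegral_monomial_coeff hf 1))
  simpa [Polynomial.algebraMap_def] using hsub _ hX

end EtaleDescent

/-! ### Localizations of étale algebras and `λ`-sequences -/

section EtaleLocal

open IsLocalRing Polynomial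

/-- Étale algebras are unramified: at a prime `P` of `B`, the prime `P ∩ A` generates the maximal
ideal. -/
theorem map_eq_maximalIdeal_of_isLocalization_atPrime {A B L : Type*} [CommRing A] [CommRing B]
    [CommRing L] [IsLocalRing L] [Algebra A B] [Algebra A L] [Algebra B L] [IsScalarTower A B L]
    [Algebra.Etale A B] (P : Ideal B) [P.IsPrime] [IsLocalization.AtPrime L P] :
    (P.comap (algebraMap A B)).map (algebraMap A L) = maximalIdeal L := by
  have h : (P.comap (algebraMap A B)).map (algebraMap A (Localization.AtPrime P)) =
      maximalIdeal (Localization.AtPrime P) := by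
    have : P.LiesOver (P.comap (algebraMap A B)) := ⟨rfl⟩
    let := Localization.AtPrime.algebraOfLiesOver (P.comap (algebraMap A B)) P
    exact ((Algebra.isUnramifiedAt_iff_map_eq A (P.comap (algebraMap A B)) P).mp inferInstance).2
  let e : Localization.AtPrime P ≃ₐ[B] L := IsLocalization.algEquiv P.primeCompl _ _
  have h2 := IsLocalRing.map_maximalIdeal_of_surjective e.toRingEquiv.toRingHom e.surjective
  rw [← h, Ideal.map_map] at h2
  rw [← h2]
  congr 1
  ext a
  rw [IsScalarTower.algebraMap_apply A B L, RingHom.comp_apply,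
    IsScalarTower.algebraMap_apply A B (Localization.AtPrime P)]
  exact (e.commutes _).symm

/-- The descent of `mem_map_of_pow_mem_map_of_smooth` after localization. -/
theorem mem_map_of_pow_mem_map_of_isLocalization {A B L : Type*} [CommRing A] [CommRing B]
    [CommRing L] [Algebra A B] [Algebra A L] [Algebra B L] [IsScalarTower A B L]
    [Algebra.Smooth A B] (N : Submonoid B) [IsLocalization N L] {I J : Ideal A} {M k : ℕ}
    (hk : 0 < k) {g : L} (hg : g ^ k ∈ (I ^ M).map (algebraMap A L))
    (hJ : ∀ g, IsIntegral (weightedRees I M k) (monomial 1 g : A[X]) → g ∈ J) :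
    g ∈ J.map (algebraMap A L) := by
  obtain ⟨⟨β, s⟩, hβ⟩ := IsLocalization.surj N g
  simp only at hβ
  have hs := IsLocalization.map_units L s
  have h1 : algebraMap B L (β ^ k) ∈ ((I ^ M).map (algebraMap A B)).map (algebraMap B L) := by
    rw [Ideal.map_map, ← IsScalarTower.algebraMap_eq, map_pow, ← hβ, mul_pow]
    exact Ideal.mul_mem_right _ _ hg
  obtain ⟨m, hm, h2⟩ := (IsLocalization.algebraMap_mem_map_algebraMap_iff N L _ _).mp h1
  have h3 : (m * β) ^ k ∈ (I ^ M).map (algebraMap A B) := by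
    rw [mul_pow, ← Nat.sub_one_add_one hk.ne', pow_succ m, mul_assoc, Nat.sub_one_add_one hk.ne']
    exact Ideal.mul_mem_left _ _ h2
  have h4 := Ideal.mem_map_of_mem (algebraMap B L) (mem_map_of_pow_mem_map_of_smooth hk h3 hJ)
  rw [Ideal.map_map, ← IsScalarTower.algebraMap_eq, map_mul, ← hβ] at h4
  have h5 := (Ideal.unit_mul_mem_iff_mem _ (IsLocalization.map_units L ⟨m, hm⟩)).mp h4
  exact (Ideal.mul_unit_mem_iff_mem _ hs).mp h5

/-- The ideals `{ν̄_I > c}` satisfy `{ν̄_{I L} > c} ⊆ {ν̄_I > c} L` for a localization `L` of a smooth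
algebra. -/
theorem mem_map_of_lt_asymptoticSamuel_of_isLocalization {A B L : Type*} [CommRing A] [CommRing B]
    [CommRing L] [Algebra A B] [Algebra A L] [Algebra B L] [IsScalarTower A B L]
    [Algebra.Smooth A B] (N : Submonoid B) [IsLocalization N L] {I : Ideal A} {c : ℝ≥0}
    {g : L} (hg : (c : ℝ≥0∞) < asymptoticSamuel (I.map (algebraMap A L)) g) :
    g ∈ (gtIdeal I c).map (algebraMap A L) := by
  obtain ⟨k, M, hk, hM, hc⟩ := (coe_lt_asymptoticSamuel_iff _).mp hg
  rw [← Ideal.map_pow] at hM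
  exact mem_map_of_pow_mem_map_of_isLocalization N hk hM fun a ha =>
    lt_asymptoticSamuel_of_isIntegral hk ha hc

/-- Reducedness ascends to localizations of smooth algebras: the case `I = 0` of the descent of
integral dependence. -/
theorem mem_map_nilradical_of_isNilpotent_of_isLocalization {A B L : Type*} [CommRing A]
    [CommRing B] [CommRing L] [Algebra A B] [Algebra A L] [Algebra B L] [IsScalarTower A B L]
    [Algebra.Smooth A B] (N : Submonoid B) [IsLocalization N L] {g : L} (hg : IsNilpotent g) :
    g ∈ (nilradical A).map (algebraMap A L) := by
  obtain ⟨k, hk⟩ := hg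
  refine mem_map_of_pow_mem_map_of_isLocalization N (I := ⊥) (M := 1) (k := k + 1) k.succ_pos
    (by rw [pow_succ g, hk, zero_mul]; exact zero_mem _) fun a ha => ?_
  have h := lt_asymptoticSamuel_of_isIntegral (c := 0) k.succ_pos ha (by simp)
  obtain ⟨l, M, -, hM, hc⟩ := (coe_lt_asymptoticSamuel_iff _).mp h
  have hM0 : M ≠ 0 := by
    rintro rfl
    simp at hc
  rw [← Ideal.zero_eq_bot, zero_pow hM0, Ideal.zero_eq_bot, Ideal.mem_bot] at hM
  exact ⟨l, hM⟩

theorem asymptoticSamuel_eq_top_of_isNilpotent {A : Type*} [CommRing A] {I : Ideal A} {g : A}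
    (hg : IsNilpotent g) : asymptoticSamuel I g = ∞ := by
  obtain ⟨k, hk⟩ := hg
  refine ENNReal.eq_top_of_forall_nnreal_le fun c => ?_
  obtain ⟨M, hM⟩ := exists_nat_gt (c * (k + 1 : ℕ) : ℝ)
  refine ((coe_lt_asymptoticSamuel_iff I).mpr ⟨k + 1, M, k.succ_pos, ?_, hM⟩).le
  rw [pow_succ, hk, zero_mul]
  exact zero_mem _

end EtaleLocal

section LinearAlgebra

open IsLocalRing

/-- The class of `x ∈ 𝔪` lies in `ker λ_𝔪` exactly when `ν̄_𝔪(x) > 1`. -/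
theorem mem_lambdaKer_iff {R : Type*} [CommRing R] [IsLocalRing R] (x : maximalIdeal R) :
    ((maximalIdeal R).toCotangent x : CotangentSpace R) ∈ lambdaKer R ↔
      1 < asymptoticSamuel (maximalIdeal R) (x : R) := by
  change lambdaMap (maximalIdeal R) _ = 0 ↔ _
  rw [lambdaMap, Ideal.Cotangent.lift_toCotangent, LinearMap.comp_apply, Submodule.mkQ_apply,
    Submodule.Quotient.mk_eq_zero]
  change ((1 : ℝ≥0) : ℝ≥0∞) < _ ↔ _
  simp

theorem mem_sup_sq_of_toCotangent_mem_span {R : Type*} [CommRing R] [IsLocalRing R] {ι : Type*}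
    {x : ι → maximalIdeal R} {y : maximalIdeal R}
    (h : ((maximalIdeal R).toCotangent y : CotangentSpace R) ∈ Submodule.span (ResidueField R)
      (Set.range fun i => ((maximalIdeal R).toCotangent (x i) : CotangentSpace R))) :
    (y : R) ∈ Ideal.span (Set.range fun i => (x i : R)) ⊔ maximalIdeal R ^ 2 := by
  suffices H : ∀ v : CotangentSpace R, v ∈ Submodule.span (ResidueField R)
      (Set.range fun i => ((maximalIdeal R).toCotangent (x i) : CotangentSpace R)) →
      ∀ y : maximalIdeal R, (maximalIdeal R).toCotangent y = v →
        (y : R) ∈ Ideal.span (Set.range fun i => (x i : R)) ⊔ maximalIdeal R ^ 2 from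
    H _ h y rfl
  intro v hv
  induction hv using Submodule.span_induction with
  | mem v hv =>
    obtain ⟨i, rfl⟩ := hv
    intro y hy
    rw [Ideal.toCotangent_eq] at hy
    have h1 : (x i : R) ∈ Ideal.span (Set.range fun i => (x i : R)) ⊔ maximalIdeal R ^ 2 :=
      Ideal.mem_sup_left (Ideal.subset_span ⟨i, rfl⟩)
    simpa using add_mem (Ideal.mem_sup_right hy) h1
  | zero =>
    intro y hy
    rw [Ideal.toCotangent_eq_zero] at hy
    exact Ideal.mem_sup_right hy
  | add v w _ _ hv hw =>
    intro y hy
    obtain ⟨y₁, rfl⟩ := (maximalIdeal R).toCotangent_surjective v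
    obtain ⟨y₂, rfl⟩ := (maximalIdeal R).toCotangent_surjective w
    rw [← map_add, Ideal.toCotangent_eq] at hy
    have := add_mem (Ideal.mem_sup_right hy) (add_mem (hv y₁ rfl) (hw y₂ rfl))
    simpa using this
  | smul c v _ hv =>
    intro y hy
    obtain ⟨y₁, rfl⟩ := (maximalIdeal R).toCotangent_surjective v
    obtain ⟨r, rfl⟩ := residue_surjective c
    have h1 : (residue R r) • ((maximalIdeal R).toCotangent y₁ : CotangentSpace R) =
      r • (maximalIdeal R).toCotangent y₁ := algebraMap_smul (ResidueField R) r _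
    rw [h1, ← map_smul, Ideal.toCotangent_eq] at hy
    have := add_mem (Ideal.mem_sup_right hy) (Ideal.mul_mem_left _ r (hv y₁ rfl))
    simpa using this

theorem toCotangent_mem_span_of_mem {R : Type*} [CommRing R] [IsLocalRing R] {ι : Type*}
    {x : ι → maximalIdeal R} {y : maximalIdeal R}
    (h : (y : R) ∈ Ideal.span (Set.range fun i => (x i : R)) ⊔ maximalIdeal R ^ 2) :
    ((maximalIdeal R).toCotangent y : CotangentSpace R) ∈ Submodule.span (ResidueField R)
      (Set.range fun i => ((maximalIdeal R).toCotangent (x i) : CotangentSpace R)) := by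
  obtain ⟨a, ha, b, hb, hab⟩ := Submodule.mem_sup.mp h
  have hle : Ideal.span (Set.range fun i => (x i : R)) ≤ maximalIdeal R := by
    rw [Ideal.span_le]
    rintro _ ⟨i, rfl⟩
    exact (x i).2
  have key : ∀ a ∈ Ideal.span (Set.range fun i => (x i : R)), ∀ h : a ∈ maximalIdeal R,
      ((maximalIdeal R).toCotangent ⟨a, h⟩ : CotangentSpace R) ∈ Submodule.span (ResidueField R)
      (Set.range fun i => ((maximalIdeal R).toCotangent (x i) : CotangentSpace R)) := by
    intro a ha
    induction ha using Submodule.span_induction with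
    | mem a ha =>
      obtain ⟨i, rfl⟩ := ha
      exact fun _ => Submodule.subset_span ⟨i, rfl⟩
    | zero =>
      intro h
      have : (⟨0, h⟩ : maximalIdeal R) = 0 := rfl
      rw [this, map_zero]; exact zero_mem _
    | add a b ha hb iha ihb =>
      intro h
      exact add_mem (iha (hle ha)) (ihb (hle hb))
    | smul r a ha iha =>
      intro h
      have := Submodule.smul_mem _ (residue R r) (iha (hle ha))
      have h1 : (residue R r) • ((maximalIdeal R).toCotangent ⟨a, hle ha⟩ : CotangentSpace R) =
        r • (maximalIdeal R).toCotangent ⟨a, hle ha⟩ := algebraMap_smul (ResidueField R) r _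
      rw [h1, ← map_smul] at this
      exact this
  have h1 : (maximalIdeal R).toCotangent y = (maximalIdeal R).toCotangent ⟨a, hle ha⟩ := by
    rw [Ideal.toCotangent_eq]
    simpa [← hab] using hb
  rw [h1]
  exact key a ha _

/-- Elements of a set `s ⊆ 𝔪` on which `ν̄_𝔪 > 1` contain a `λ_𝔪`-sequence as soon as they
generate, over some local extension `L`, sufficiently many elements with independent classes. -/
theorem exists_isLambdaSequence_of_mem_span {R L : Type*} [CommRing R] [CommRing L]
    [IsLocalRing R] [IsLocalRing L] [IsNoetherianRing R] [IsNoetherianRing L] (f : R →+* L)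
    (hf : (maximalIdeal R).map f ≤ maximalIdeal L) {s : Set R} (hs : ∀ x ∈ s, x ∈ maximalIdeal R)
    (hs1 : ∀ x ∈ s, 1 < asymptoticSamuel (maximalIdeal R) x) {t : ℕ}
    (ht : Module.finrank (ResidueField R) (lambdaKer R) = t) {y : Fin t → maximalIdeal L}
    (hy : LinearIndependent (ResidueField L)
      (fun i => ((maximalIdeal L).toCotangent (y i) : CotangentSpace L)))
    (hys : ∀ i, (y i : L) ∈ Ideal.span (f '' s)) :
    ∃ γ : Fin t → R, (∀ i, γ i ∈ s) ∧ IsLambdaSequence R γ := by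
  set V : Set (CotangentSpace R) := {v | ∃ x : maximalIdeal R, (x : R) ∈ s ∧
    (maximalIdeal R).toCotangent x = v} with hV
  have hVle : Submodule.span (ResidueField R) V ≤ lambdaKer R := by
    rw [Submodule.span_le]
    rintro _ ⟨x, hx, rfl⟩
    exact (mem_lambdaKer_iff x).mpr (hs1 _ hx)
  obtain ⟨v, hvV, hvspan, hvli⟩ := Submodule.exists_fun_fin_finrank_span_eq (ResidueField R) V
  choose x hxs hxv using hvV
  have hvx : v = fun i => ((maximalIdeal R).toCotangent (x i) : CotangentSpace R) :=
    (funext hxv).symm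
  have hsup : ∀ z ∈ s, z ∈ Ideal.span (Set.range fun i => (x i : R)) ⊔ maximalIdeal R ^ 2 := by
    intro z hz
    refine mem_sup_sq_of_toCotangent_mem_span (y := ⟨z, hs z hz⟩) ?_
    rw [← hvx, hvspan]
    exact Submodule.subset_span ⟨_, hz, rfl⟩
  let x' : Fin (Module.finrank (ResidueField R) (Submodule.span (ResidueField R) V)) →
    maximalIdeal L := fun i => ⟨f (x i), hf (Ideal.mem_map_of_mem f (x i).2)⟩
  have hsup' : ∀ i, (y i : L) ∈ Ideal.span (Set.range fun i => (x' i : L)) ⊔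
      maximalIdeal L ^ 2 := by
    have hle : Ideal.span (f '' s) ≤ Ideal.span (Set.range fun i => (x' i : L)) ⊔
        maximalIdeal L ^ 2 := by
      rw [Ideal.span_le]
      rintro _ ⟨z, hz, rfl⟩
      have h1 := Ideal.mem_map_of_mem f (hsup z hz)
      rw [Ideal.map_sup, Ideal.map_span, Ideal.map_pow, ← Set.range_comp] at h1
      exact sup_le_sup_left (Ideal.pow_right_mono hf 2) _ h1
    exact fun i => hle (hys i)
  have hspan : Submodule.span (ResidueField L) (Set.range fun i =>
      ((maximalIdeal L).toCotangent (y i) : CotangentSpace L)) ≤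
      Submodule.span (ResidueField L) (Set.range fun i =>
        ((maximalIdeal L).toCotangent (x' i) : CotangentSpace L)) := by
    rw [Submodule.span_le]
    rintro _ ⟨i, rfl⟩
    exact toCotangent_mem_span_of_mem (hsup' i)
  have hle : t ≤ Module.finrank (ResidueField R) (Submodule.span (ResidueField R) V) := by
    have h1 := Submodule.finrank_mono hspan
    rw [finrank_span_eq_card hy, Fintype.card_fin] at h1
    exact (h1.trans (finrank_range_le_card _)).trans_eq (Fintype.card_fin _)
  have heq : Submodule.span (ResidueField R) V = lambdaKer R :=
    Submodule.eq_of_le_of_finrank_le hVle (ht.trans_le hle)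
  have hn : Module.finrank (ResidueField R) (Submodule.span (ResidueField R) V) = t := by
    rw [heq, ht]
  subst hvx
  clear hspan hsup' x' hsup
  revert x
  rw [hn]
  intro x hxs hvspan hvli _
  exact ⟨fun i => x i, hxs, fun i => (x i).2, hvli, hvspan.trans heq⟩

end LinearAlgebra

end SamuelSlope

theorem proposition3p8 {A A' : Type*} [CommRing A] [IsLocalRing A] [IsNoetherianRing A]
    [CommRing A'] [IsLocalRing A'] [Algebra A A'] [IsLocalHom (algebraMap A A')]
    (d r t m : ℕ)
    (hA : SamuelSlope.IsFormallyEquidimensional A d)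
    (p : Ideal A) [p.IsPrime]
    (hreg : IsRegularLocalRing (A ⧸ p))
    (hr : 0 < r) (hdim : ringKrullDim (A ⧸ p) + r = d)
    (hm : 1 < m)
    (hmult : SamuelSlope.HasMultiplicity A m)
    (hmult_p : SamuelSlope.HasMultiplicity (Localization.AtPrime p) m)
    (ht : SamuelSlope.excessEmbDim A = t)
    (ht_p : SamuelSlope.excessEmbDim (Localization.AtPrime p) = t)
    (hext : SamuelSlope.IsExtremal A)
    (hext_p : SamuelSlope.IsExtremal (Localization.AtPrime p))
    (hetale : SamuelSlope.IsEtaleLocal A A')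
    (p' : Ideal A') [p'.IsPrime] (hp' : p'.comap (algebraMap A A') = p)
    (hres : Function.Bijective (IsLocalRing.ResidueField.map (algebraMap A A')))
    (γ' : Fin t → A')
    (hγ' : SamuelSlope.IsLambdaSequence A' γ')
    (hγ'_p : SamuelSlope.IsLambdaSequence (Localization.AtPrime p')
      (fun i => algebraMap A' (Localization.AtPrime p') (γ' i))) :
    (∃ γ : Fin t → A, (∀ i, γ i ∈ p) ∧
      SamuelSlope.IsLambdaSequence (Localization.AtPrime p)
        (fun i => algebraMap A (Localization.AtPrime p) (γ i)) ∧
      (⨅ i, SamuelSlope.asymptoticSamuel p' (γ' i)) ≤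
        (⨅ i, SamuelSlope.asymptoticSamuel p (γ i)) ∧
      (⨅ i, SamuelSlope.asymptoticSamuel
          (IsLocalRing.maximalIdeal (Localization.AtPrime p'))
          (algebraMap A' (Localization.AtPrime p') (γ' i))) ≤
        (⨅ i, SamuelSlope.asymptoticSamuel
          (IsLocalRing.maximalIdeal (Localization.AtPrime p))
          (algebraMap A (Localization.AtPrime p) (γ i)))) ∧
    (⨅ i, SamuelSlope.asymptoticSamuel
        (IsLocalRing.maximalIdeal (Localization.AtPrime p'))
        (algebraMap A' (Localization.AtPrime p') (γ' i))) ≤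
      SamuelSlope.samuelSlope (Localization.AtPrime p) := by
  obtain ⟨B, _, _, _, q, hq, _, _, _, -⟩ := hetale
  subst ht_p
  have ht0 : Nonempty (Fin (SamuelSlope.excessEmbDim (Localization.AtPrime p))) :=
    ⟨⟨0, hext_p.1⟩⟩
  set L := Localization.AtPrime p' with hL
  have hAAL : IsScalarTower A A' L := inferInstance
  have hBAL : IsScalarTower B A' L := inferInstance
  have hABL : IsScalarTower A B L := IsScalarTower.of_algebraMap_eq fun a => by
    rw [IsScalarTower.algebraMap_apply A A' L, IsScalarTower.algebraMap_apply A B A',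
      IsScalarTower.algebraMap_apply B A' L]
  set P : Ideal B := p'.comap (algebraMap B A') with hP
  have hPL : IsLocalization.AtPrime L P :=
    IsLocalization.isLocalization_isLocalization_atPrime_isLocalization q.primeCompl L p'
  have hPp : P.comap (algebraMap A B) = p := by
    rw [hP, Ideal.comap_comap, ← IsScalarTower.algebraMap_eq, hp']
  have hBN : IsNoetherianRing B := Algebra.FiniteType.isNoetherianRing A B
  have hLN : IsNoetherianRing L := IsLocalization.isNoetherianRing P.primeCompl L hBN
  have hpL : p.map (algebraMap A L) = IsLocalRing.maximalIdeal L := by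
    rw [← hPp]
    exact SamuelSlope.map_eq_maximalIdeal_of_isLocalization_atPrime P
  have hpR : p.map (algebraMap A (Localization.AtPrime p)) =
      IsLocalRing.maximalIdeal (Localization.AtPrime p) :=
    Localization.AtPrime.map_eq_maximalIdeal
  set b := ⨅ i, SamuelSlope.asymptoticSamuel (IsLocalRing.maximalIdeal L)
    (algebraMap A' L (γ' i)) with hb
  obtain ⟨hmem, hli, hspan⟩ := hγ'_p
  have hb1 : 1 < b := by
    obtain ⟨i, hi⟩ := exists_eq_ciInf_of_finite (f := fun i =>
      SamuelSlope.asymptoticSamuel (IsLocalRing.maximalIdeal L) (algebraMap A' L (γ' i)))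
    rw [hb, ← hi]
    refine (SamuelSlope.mem_lambdaKer_iff ⟨_, hmem i⟩).mp ?_
    rw [← hspan]
    exact Submodule.subset_span ⟨i, rfl⟩
  -- the ideal `J` collects the elements of `A` which are allowed as `γ i`
  obtain ⟨J, hJ, hJγ⟩ : ∃ J : Ideal A, (∀ g ∈ J, b ≤ SamuelSlope.asymptoticSamuel p g) ∧
      ∀ i, algebraMap A' L (γ' i) ∈ J.map (algebraMap A L) := by
    rcases eq_or_ne b ∞ with htop | htop
    · refine ⟨nilradical A, fun g hg => ?_, fun i => ?_⟩
      · rw [SamuelSlope.asymptoticSamuel_eq_top_of_isNilpotent hg]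
        exact le_top
      · refine SamuelSlope.mem_map_nilradical_of_isNilpotent_of_isLocalization P.primeCompl
          (SamuelSlope.isNilpotent_of_asymptoticSamuel_eq_top
            (IsLocalRing.maximalIdeal.isMaximal L).ne_top (top_le_iff.mp ?_))
        rw [← htop]
        exact iInf_le _ i
    · lift b to ℝ≥0 using htop with b'
      obtain ⟨c, hc, hgap⟩ := SamuelSlope.hasLeftGaps p b'
        (lt_trans one_pos (by exact_mod_cast hb1))
      refine ⟨SamuelSlope.gtIdeal p c, hgap, fun i => ?_⟩
      refine SamuelSlope.mem_map_of_lt_asymptoticSamuel_of_isLocalization P.primeCompl ?_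
      rw [hpL]
      exact (ENNReal.coe_lt_coe.mpr hc).trans_le (hb.trans_le (iInf_le _ i))
  have hJp : J ≤ p := by
    intro g hg
    have h1 : ((1 : ℝ≥0) : ℝ≥0∞) < SamuelSlope.asymptoticSamuel p g := by
      simpa using hb1.trans_le (hJ g hg)
    obtain ⟨k, M, -, hM, hc⟩ := (SamuelSlope.coe_lt_asymptoticSamuel_iff p).mp h1
    have hM0 : M ≠ 0 := by
      rintro rfl
      have : (0 : ℝ) ≤ ((1 : ℝ≥0) : ℝ) * k := by positivity
      simp only [Nat.cast_zero] at hc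
      linarith
    exact Ideal.IsPrime.mem_of_pow_mem inferInstance k (Ideal.pow_le_self hM0 hM)
  have hloc : ∀ g, SamuelSlope.asymptoticSamuel p g ≤ SamuelSlope.asymptoticSamuel
      (IsLocalRing.maximalIdeal (Localization.AtPrime p))
      (algebraMap A (Localization.AtPrime p) g) :=
    SamuelSlope.asymptoticSamuel_le_of_map_le _ hpR.le
  let f : Localization.AtPrime p →+* L := IsLocalization.lift (M := p.primeCompl)
    (g := algebraMap A L) fun s => by
      rw [← not_not (a := IsUnit _), ← mem_nonunits_iff, ← IsLocalRing.mem_maximalIdeal,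
        IsScalarTower.algebraMap_apply A A' L,
        IsLocalization.AtPrime.to_map_mem_maximal_iff L p']
      intro h
      exact s.2 (hp' ▸ h)
  have hfA : f.comp (algebraMap A (Localization.AtPrime p)) = algebraMap A L :=
    IsLocalization.lift_comp _
  obtain ⟨γ₁, hγ₁, hγ₁'⟩ := SamuelSlope.exists_isLambdaSequence_of_mem_span f
    (by rw [← hpR, Ideal.map_map, hfA, hpL])
    (s := algebraMap A (Localization.AtPrime p) '' J)
    (by
      rintro _ ⟨g, hg, rfl⟩
      rw [← hpR]
      exact Ideal.mem_map_of_mem _ (hJp hg))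
    (by
      rintro _ ⟨g, hg, rfl⟩
      exact (hb1.trans_le (hJ g hg)).trans_le (hloc g))
    hext_p.2 hli
    (by
      intro i
      rw [← Set.image_comp, ← RingHom.coe_comp, hfA]
      exact hJγ i)
  choose γ hγJ hγ using hγ₁
  have hγ₁γ : γ₁ = fun i => algebraMap A (Localization.AtPrime p) (γ i) :=
    (funext hγ).symm
  subst hγ₁γ
  have hbγ : b ≤ ⨅ i, SamuelSlope.asymptoticSamuel
      (IsLocalRing.maximalIdeal (Localization.AtPrime p))
      (algebraMap A (Localization.AtPrime p) (γ i)) :=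
    le_iInf fun i => (hJ _ (hγJ i)).trans (hloc _)
  refine ⟨⟨γ, fun i => hJp (hγJ i), hγ₁', ?_, hbγ⟩, ?_⟩
  · refine le_trans ?_ (le_iInf fun i => hJ _ (hγJ i))
    exact iInf_mono fun i => SamuelSlope.asymptoticSamuel_le_of_map_le _
      (Localization.AtPrime.map_eq_maximalIdeal (I := p')).le _
  · rw [SamuelSlope.samuelSlope, if_pos hext_p]
    exact le_iSup₂_of_le _ hγ₁' hbγ
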